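/- Let $H$ be a separable complex Hilbert space with orthonormal basis $\{e_i : i\in\Theta\}$, where $\Theta$ is countable with at least two elements ($\Theta=\{1,\dots,n\}$ with $n>1$, or $\Theta=\mathbb N$). Let $\mathcal F(H)=\bigoplus_{n\ge 0}H^{\otimes n}$ be the full Fock space with vacuum vector $\Omega$, let $l_i$ be the left creation operator $l_i\eta=e_i\otimes\eta$, and for a finite word $I=i_1\cdots i_k$ in $\Theta$ put $e_I=e_{i_1}\otimes\cdots\otimes e_{i_k}$ (with $e_I=\Omega$ for the empty word). Let $(\omega_i)_{i\in\Theta}$ be positive reals with $\sum_i\omega_i=1$ and let $$P_\omega(x)=\sum_{i\in\Theta}\omega_i\,l_i^*\,x\,l_i\qquad(x\in B(\mathcal F(H))).$$ Let $F(P_\omega)=\{x: P_\omega(x)=x\}$ be the Poisson boundary, and let $P(P_\omega)$, the peripheral Poisson boundary, be the norm closed linear span of all $x$ with $P_\omega(x)=\lambda x$ for some $\lambda\in\mathbb C$ with $|\lambda|=1$. Let $(K,\mathcal B,\theta)$ be the minimal dilation of $P_\omega$ to a normal unital $*$-endomorphism $\theta$ of a von Neumann algebra $\mathcal B\subseteq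 B(K)$, where $K\supseteq\mathcal F(H)$, let $p$ be the projection of $K$ onto $\mathcal F(H)$, and define $P(\theta)$ for $\theta$ as $P(P_\omega)$ was defined for $P_\omega$. The compression $T(z)=pzp$ maps $P(\theta)$ bijectively onto $P(P_\omega)$, and $P(P_\omega)$ carries the product $x\circ y=T(T^{-1}(x)T^{-1}(y))$. Then the relative commutant of $F(P_\omega)$ in $P(P_\omega)$ is trivial: $$\{x\in P(P_\omega): x\circ y=y\circ x\ \text{ for all } y\in F(P_\omega)\}=\mathbb C\,1 .$$ More precisely, every $x$ in this set satisfies $\langle x e_I,e_J\rangle=\delta_{I,J}\langle x\Omega,\Omega\rangle$ for all finite words $I,J$ in $\Theta$, that is, $x=\langle x\Omega,\Omega\rangle 1$. -/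

import Mathlib

open scoped TensorProduct

universe u v w

noncomputable section

namespace FullFock

/-! ## Hilbert space tensor powers and the full Fock space -/

/-- A complex Hilbert space, bundled, so that tensor powers can be defined by recursion. -/
structure HilbertBundle where
  carrier : Type u
  [normedGroup : NormedAddCommGroup carrier]
  [innerProduct : InnerProductSpace ℂ carrier]
  [complete : CompleteSpace carrier]

attribute [instance] HilbertBundle.normedGroup HilbertBundle.innerProduct HilbertBundle.complete

section Fock

variable (H : Type u) [NormedAddCommGroup H] [InnerProductSpace ℂ H]

/-- `H^{⊗ 0}` is the one-dimensional Hilbert space `ℂ Ω`, and `H^{⊗ (n+1)}` is the Hilbert space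
tensor product (the completion of the algebraic one) of `H` and `H^{⊗ n}`. -/
def tensorPowerBundle : ℕ → HilbertBundle.{u}
  | 0 => ⟨EuclideanSpace ℂ PUnit.{u + 1}⟩
  | n + 1 => ⟨UniformSpace.Completion (H ⊗[ℂ] (tensorPowerBundle n).carrier)⟩

/-- The Hilbert space tensor power `H^{⊗ n}`. -/
abbrev TensorPower (n : ℕ) : Type u := (tensorPowerBundle H n).carrier

/-- The full Fock space: the Hilbert space direct sum of all `H^{⊗ n}`, `n ≥ 0`. -/
abbrev FockSpace : Type u := lp (fun n : ℕ => TensorPower H n) 2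

variable {H}

/-- The map `η ↦ ξ ⊗ η` from `H^{⊗ n}` to `H^{⊗ (n+1)}`. -/
def tensorCons (ξ : H) (n : ℕ) : TensorPower H n →L[ℂ] TensorPower H (n + 1) :=
  (UniformSpace.Completion.toComplL (𝕜 := ℂ) (E := H ⊗[ℂ] TensorPower H n)) ∘L
    (TensorProduct.mkL ℂ H (TensorPower H n) ξ)

theorem inner_tensorCons (ξ ξ' : H) (n : ℕ) (η η' : TensorPower H n) :
    inner ℂ (tensorCons ξ n η) (tensorCons ξ' n η') = inner ℂ ξ ξ' * inner ℂ η η' :=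
  (UniformSpace.Completion.inner_coe (𝕜 := ℂ) (ξ ⊗ₜ[ℂ] η) (ξ' ⊗ₜ[ℂ] η')).trans
    (TensorProduct.inner_tmul ℂ ξ ξ' η η')

theorem norm_tensorCons (ξ : H) (n : ℕ) (η : TensorPower H n) :
    ‖tensorCons ξ n η‖ = ‖ξ‖ * ‖η‖ :=
  (UniformSpace.Completion.norm_coe (ξ ⊗ₜ[ℂ] η)).trans (TensorProduct.norm_tmul ξ η)

/-- The pure tensor `ξ₁ ⊗ ⋯ ⊗ ξₙ`; the empty tensor is `Ω`. -/
def pureTensor : (L : List H) → TensorPower H L.length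
  | [] => EuclideanSpace.single PUnit.unit (1 : ℂ)
  | ξ :: L => tensorCons ξ L.length (pureTensor L)

/-- The pure tensor `ξ₁ ⊗ ⋯ ⊗ ξₙ` as a vector of the full Fock space. -/
def pureVector (L : List H) : FockSpace H :=
  lp.single 2 L.length (pureTensor L)

variable (H) in
/-- The vacuum vector `Ω`. -/
def vacuum : FockSpace H := pureVector []

/-- The coordinates of `ξ ⊗ η`, for `η` in the full Fock space. -/
def creationFun (ξ : H) (η : ∀ n, TensorPower H n) : ∀ n, TensorPower H n
  | 0 => 0
  | n + 1 => tensorCons ξ n (η n)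

theorem hasSum_creationFun (ξ : H) (η : FockSpace H) :
    HasSum (fun n => ‖creationFun ξ η n‖ ^ 2) (‖ξ‖ ^ 2 * ‖η‖ ^ 2) := by
  have h := lp.hasSum_norm (p := 2) (by norm_num) η
  have h' : HasSum (fun n => ‖η n‖ ^ 2) (‖η‖ ^ 2) := by simpa using h
  have h2 : HasSum (fun n => ‖creationFun ξ η (n + 1)‖ ^ 2) (‖ξ‖ ^ 2 * ‖η‖ ^ 2) := by
    simpa [creationFun, norm_tensorCons, mul_pow] using h'.mul_left (‖ξ‖ ^ 2)
  rw [hasSum_nat_add_iff (f := fun n => ‖creationFun ξ η n‖ ^ 2) 1] at h2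
  simpa [creationFun] using h2

theorem memℓp_creationFun (ξ : H) (η : FockSpace H) : Memℓp (creationFun ξ η) 2 := by
  apply memℓp_gen
  simpa using (hasSum_creationFun ξ η).summable

/-- The left creation operator `l_ξ η = ξ ⊗ η` as a linear map. -/
def leftCreationLin (ξ : H) : FockSpace H →ₗ[ℂ] FockSpace H where
  toFun η := ⟨creationFun ξ η, memℓp_creationFun ξ η⟩
  map_add' η η' := by
    ext n
    cases n with
    | zero => exact (add_zero 0).symm
    | succ n => exact map_add (tensorCons ξ n) (η n) (η' n)
  map_smul' c η := by
    ext n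
    cases n with
    | zero => simp [creationFun]
    | succ n => simp [creationFun]

theorem norm_leftCreationLin (ξ : H) (η : FockSpace H) :
    ‖leftCreationLin ξ η‖ = ‖ξ‖ * ‖η‖ := by
  have h := lp.hasSum_norm (p := 2) (by norm_num) (leftCreationLin ξ η)
  have h' : HasSum (fun n => ‖creationFun ξ η n‖ ^ 2) (‖leftCreationLin ξ η‖ ^ 2) := by
    simpa [leftCreationLin] using h
  have := h'.unique (hasSum_creationFun ξ η)
  rw [← mul_pow] at this
  exact (pow_left_inj₀ (by positivity) (by positivity) (by norm_num)).1 this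

/-- The left creation operator `l_ξ`, a bounded operator on the full Fock space with
`l_ξ η = ξ ⊗ η`. -/
def leftCreation (ξ : H) : FockSpace H →L[ℂ] FockSpace H :=
  (leftCreationLin ξ).mkContinuous ‖ξ‖ fun η => (norm_leftCreationLin ξ η).le

theorem norm_leftCreation_apply (ξ : H) (η : FockSpace H) :
    ‖leftCreation ξ η‖ = ‖ξ‖ * ‖η‖ := norm_leftCreationLin ξ η

theorem leftCreation_apply_succ (ξ : H) (η : FockSpace H) (n : ℕ) :
    leftCreation ξ η (n + 1) = tensorCons ξ n (η n) := rfl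

theorem leftCreation_apply_zero (ξ : H) (η : FockSpace H) :
    leftCreation ξ η 0 = 0 := rfl

theorem leftCreation_pureVector (ξ : H) (L : List H) :
    leftCreation ξ (pureVector L) = pureVector (ξ :: L) := by
  ext n
  rcases n with _ | n
  · rw [leftCreation_apply_zero, pureVector, lp.single_apply_ne]
    simp
  · rw [leftCreation_apply_succ, pureVector, pureVector]
    by_cases hn : n = L.length
    · subst hn
      exact (congrArg _ (lp.single_apply_self _ _ _)).trans
        (lp.single_apply_self 2 (L.length + 1) (pureTensor (ξ :: L))).symm
    · rw [lp.single_apply_ne 2 _ _ hn, lp.single_apply_ne, map_zero]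
      simpa using hn

end Fock

/-! ## Fixed points, peripheral eigenvectors, dilations, and the product -/

/-- The Poisson boundary (fixed point space) of `τ`, as a set. -/
def fixedSpace {A : Type u} (τ : A → A) : Set A := {x | τ x = x}

/-- The peripheral Poisson boundary of `τ`: the norm closed linear span of the eigenvectors of
`τ` for eigenvalues of modulus one. -/
def peripheralSpace {A : Type u} [NormedRing A] [NormedAlgebra ℂ A] (τ : A → A) :
    Submodule ℂ A :=
  (Submodule.span ℂ {x : A | ∃ c : ℂ, ‖c‖ = 1 ∧ τ x = c • x}).topologicalClosure

section Dilation

variable {G : Type u} [NormedAddCommGroup G] [InnerProductSpace ℂ G] [CompleteSpace G]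
variable {K : Type v} [NormedAddCommGroup K] [InnerProductSpace ℂ K] [CompleteSpace K]

/-- For an isometric embedding `V : G → K`, the operator `x` on `G` regarded as an operator on
`K` (namely `V x V*`, which is zero on the orthogonal complement of `G`). -/
def cornerEmbed (V : G →ₗᵢ[ℂ] K) (x : G →L[ℂ] G) : K →L[ℂ] K :=
  V.toContinuousLinearMap ∘L x ∘L ContinuousLinearMap.adjoint V.toContinuousLinearMap

/-- The compression `V* z V` of an operator on `K` to the subspace `G`. -/
def compress (V : G →ₗᵢ[ℂ] K) (z : K →L[ℂ] K) : G →L[ℂ] G :=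
  ContinuousLinearMap.adjoint V.toContinuousLinearMap ∘L z ∘L V.toContinuousLinearMap

/-- A map between algebras of operators is normal if it is ultraweakly continuous on norm bounded
sets; on these the ultraweak and the weak operator topology agree. -/
def IsNormalMap {A : StarSubalgebra ℂ (K →L[ℂ] K)} (f : A → A) : Prop :=
  ∀ (C : ℝ) (l : Filter A) (a : A), (∀ᶠ b : A in l, ‖(b : K →L[ℂ] K)‖ ≤ C) →
    (∀ ξ η : K, Filter.Tendsto (fun b : A => inner ℂ ξ ((b : K →L[ℂ] K) η)) l
      (nhds (inner ℂ ξ ((a : K →L[ℂ] K) η)))) →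
    ∀ ξ η : K, Filter.Tendsto (fun b : A => inner ℂ ξ ((f b : K →L[ℂ] K) η)) l
      (nhds (inner ℂ ξ ((f a : K →L[ℂ] K) η)))

variable (K) in
/-- A minimal dilation `(K, B, θ)` of a map `τ : B(G) → B(G)`: a Hilbert space `K` containing `G`,
a von Neumann algebra `B` on `K` whose corner on `G` is `B(G)`, and a normal unital
`*`-endomorphism `θ` of `B` whose powers compress to those of `τ`, such that `B` is generated by
the `θⁿ(x)`, `x ∈ B(G)`, and `K` is the closed span of the vectors
`θ^{n₁}(x₁) ⋯ θ^{n_k}(x_k) g` with `g ∈ G`. -/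
structure MinimalDilation (τ : (G →L[ℂ] G) → (G →L[ℂ] G)) where
  /-- the inclusion of `G` into `K` -/
  incl : G →ₗᵢ[ℂ] K
  /-- the von Neumann algebra `B` -/
  alg : VonNeumannAlgebra K
  /-- the endomorphism `θ` -/
  endo : alg.toStarSubalgebra →⋆ₐ[ℂ] alg.toStarSubalgebra
  normal : IsNormalMap endo
  corner_mem : ∀ x : G →L[ℂ] G, cornerEmbed incl x ∈ alg.toStarSubalgebra
  dilates : ∀ (n : ℕ) (x : G →L[ℂ] G),
    compress incl (endo^[n] ⟨cornerEmbed incl x, corner_mem x⟩ : alg.toStarSubalgebra) = τ^[n] x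
  generates : Set.centralizer (Set.centralizer {z : K →L[ℂ] K | ∃ (n : ℕ) (x : G →L[ℂ] G),
    z = (endo^[n] ⟨cornerEmbed incl x, corner_mem x⟩ : alg.toStarSubalgebra)}) =
      (alg : Set (K →L[ℂ] K))
  cyclic : (Submodule.span ℂ {k : K | ∃ (L : List (ℕ × (G →L[ℂ] G))) (g : G),
    k = (L.map fun q => ((endo^[q.1] ⟨cornerEmbed incl q.2, corner_mem q.2⟩ :
      alg.toStarSubalgebra) : K →L[ℂ] K)).prod (incl g)}).topologicalClosure = ⊤

namespace MinimalDilation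

variable {τ : (G →L[ℂ] G) → (G →L[ℂ] G)}

/-- The compression map `T : z ↦ p z p` from `B` to `B(G)`. -/
def compression (D : MinimalDilation K τ) (z : D.alg.toStarSubalgebra) : G →L[ℂ] G :=
  compress D.incl (z : K →L[ℂ] K)

/-- The inverse of the compression map `T`, which maps the peripheral Poisson boundary of `θ`
bijectively onto that of `τ`. -/
def lift (D : MinimalDilation K τ) (x : G →L[ℂ] G) : D.alg.toStarSubalgebra :=
  Function.invFunOn D.compression (peripheralSpace D.endo : Set D.alg.toStarSubalgebra) x

/-- The product `x ∘ y = T (T⁻¹(x) T⁻¹(y))` of the peripheral Poisson boundary. -/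
def circ (D : MinimalDilation K τ) (x y : G →L[ℂ] G) : G →L[ℂ] G :=
  D.compression (D.lift x * D.lift y)

/-- The relative commutant of the Poisson boundary in the peripheral Poisson boundary. -/
def relativeCommutant (D : MinimalDilation K τ) : Set (G →L[ℂ] G) :=
  {x | x ∈ peripheralSpace τ ∧ ∀ y ∈ fixedSpace τ, D.circ x y = D.circ y x}

end MinimalDilation

end Dilation

/-! ## The map `P_ω` -/

section Map

variable {H : Type u} [NormedAddCommGroup H] [InnerProductSpace ℂ H]
variable {Θ : Type v}

/-- The vector `e_I = e_{i₁} ⊗ ⋯ ⊗ e_{i_k}` for a word `I = i₁ ⋯ i_k`, with `e_I = Ω` for the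
empty word. -/
def wordVector (e : HilbertBasis Θ ℂ H) (I : List Θ) : FockSpace H :=
  pureVector (I.map e)

/-- The map `P_ω(x) = ∑ᵢ ωᵢ lᵢ* x lᵢ` on the bounded operators of the full Fock space; the series
converges in norm. -/
def fockMap (e : HilbertBasis Θ ℂ H) (ω : Θ → ℝ) (x : FockSpace H →L[ℂ] FockSpace H) :
    FockSpace H →L[ℂ] FockSpace H :=
  ∑' i, (ω i : ℂ) • (ContinuousLinearMap.adjoint (leftCreation (e i)) ∘L x ∘L leftCreation (e i))

theorem summable_fockMap (e : HilbertBasis Θ ℂ H) {ω : Θ → ℝ} (hω : Summable ω)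
    (x : FockSpace H →L[ℂ] FockSpace H) :
    Summable fun i => (ω i : ℂ) •
      (ContinuousLinearMap.adjoint (leftCreation (e i)) ∘L x ∘L leftCreation (e i)) := by
  have hl : ∀ i, ‖leftCreation (e i)‖ ≤ 1 := fun i =>
    ContinuousLinearMap.opNorm_le_bound _ zero_le_one fun η => by
      rw [norm_leftCreation_apply, e.orthonormal.1 i]
  refine Summable.of_norm_bounded (hω.abs.mul_right ‖x‖) fun i => ?_
  rw [norm_smul, Complex.norm_real, Real.norm_eq_abs]
  refine mul_le_mul_of_nonneg_left ?_ (abs_nonneg _)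
  calc _ ≤ ‖ContinuousLinearMap.adjoint (leftCreation (e i))‖ * (‖x‖ * ‖leftCreation (e i)‖) :=
        (ContinuousLinearMap.opNorm_comp_le _ _).trans
          (mul_le_mul_of_nonneg_left (ContinuousLinearMap.opNorm_comp_le _ _) (norm_nonneg _))
    _ ≤ 1 * (‖x‖ * 1) := by
        rw [LinearIsometryEquiv.norm_map]
        gcongr
        · exact hl i
        · exact hl i
    _ = ‖x‖ := by ring

end Map


/-! ## Existence of a minimal dilation

The following shows that the notions above are not void: `P_ω` has a minimal dilation. -/

section Existence

variable {Θ : Type v}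
variable {E : Type u} [NormedAddCommGroup E] [InnerProductSpace ℂ E]
variable {F : Type w} [NormedAddCommGroup F] [InnerProductSpace ℂ F]

theorem hasSum_norm_sq {ι : Type*} {X : ι → Type*} [∀ i, NormedAddCommGroup (X i)]
    (u : lp X 2) : HasSum (fun i => ‖u i‖ ^ 2) (‖u‖ ^ 2) := by
  simpa using lp.hasSum_norm (p := 2) (by norm_num) u

theorem memℓp_amp (Z : E →L[ℂ] F) (u : lp (fun _ : Θ => E) 2) :
    Memℓp (fun i => Z (u i) : Θ → F) 2 := by
  apply memℓp_gen
  have h := (hasSum_norm_sq u).summable.mul_left (‖Z‖ ^ 2)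
  refine Summable.of_nonneg_of_le (fun i => by positivity) (fun i => ?_) h
  have := Z.le_opNorm (u i)
  simpa [mul_pow] using pow_le_pow_left₀ (norm_nonneg _) this 2

/-- The diagonal operator `⨁ᵢ Z` between Hilbert space direct sums. -/
def amp (Θ : Type v) (Z : E →L[ℂ] F) : lp (fun _ : Θ => E) 2 →L[ℂ] lp (fun _ : Θ => F) 2 :=
  LinearMap.mkContinuous
    { toFun := fun u => ⟨fun i => Z (u i), memℓp_amp Z u⟩
      map_add' := fun u v => by
        ext i
        exact map_add Z (u i) (v i)
      map_smul' := fun c u => by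
        ext i
        exact map_smul Z c (u i) } ‖Z‖ (by
    intro u
    have h1 := hasSum_norm_sq (⟨fun i => Z (u i), memℓp_amp Z u⟩ : lp (fun _ : Θ => F) 2)
    have h2 := (hasSum_norm_sq u).mul_left (‖Z‖ ^ 2)
    have := hasSum_le (fun i => by
      have := Z.le_opNorm (u i)
      simpa [mul_pow] using pow_le_pow_left₀ (norm_nonneg _) this 2) h1 h2
    rw [← mul_pow] at this
    exact (pow_le_pow_iff_left₀ (norm_nonneg _) (by positivity) two_ne_zero).1 this)

@[simp] theorem amp_apply (Z : E →L[ℂ] F) (u : lp (fun _ : Θ => E) 2) (i : Θ) :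
    amp Θ Z u i = Z (u i) := rfl

theorem amp_single [DecidableEq Θ] (Z : E →L[ℂ] F) (i : Θ) (x : E) :
    amp Θ Z (lp.single 2 i x) = lp.single 2 i (Z x) := by
  ext j
  rw [amp_apply]
  by_cases h : j = i
  · subst h; simp
  · simp [h]

theorem inner_amp_isometry (V : E →ₗᵢ[ℂ] F) (u v : lp (fun _ : Θ => E) 2) :
    inner ℂ (amp Θ V.toContinuousLinearMap u) (amp Θ V.toContinuousLinearMap v) =
      inner ℂ u v := by
  rw [lp.inner_eq_tsum, lp.inner_eq_tsum]
  simp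

variable {G : Type u} [NormedAddCommGroup G] [InnerProductSpace ℂ G] [CompleteSpace G]
variable {K : Type w} [NormedAddCommGroup K] [InnerProductSpace ℂ K] [CompleteSpace K]

/-- The endomorphism `Z ↦ R* (⨁ᵢ Z) R` of `B(K)` given by a unitary `R : K → ⨁ᵢ K`. -/
def shiftEndo (R : K ≃ₗᵢ[ℂ] lp (fun _ : Θ => K) 2) : (K →L[ℂ] K) →⋆ₐ[ℂ] (K →L[ℂ] K) where
  toFun Z := R.symm.toContinuousLinearEquiv.toContinuousLinearMap ∘L amp Θ Z ∘L
    R.toContinuousLinearEquiv.toContinuousLinearMap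
  map_one' := by
    ext k
    exact R.symm_apply_eq.2 (by ext i; rfl)
  map_zero' := by
    ext k
    exact R.symm_apply_eq.2 (by ext i; simp)
  map_mul' Z Z' := by
    ext k
    exact R.symm_apply_eq.2 (by ext i; simp)
  map_add' Z Z' := by
    ext k
    exact R.symm_apply_eq.2 (by ext i; simp)
  commutes' c := by
    ext k
    exact R.symm_apply_eq.2 (by ext i; simp [Algebra.algebraMap_eq_smul_one])
  map_star' Z := by
    rw [ContinuousLinearMap.star_eq_adjoint, ContinuousLinearMap.star_eq_adjoint]
    rw [ContinuousLinearMap.eq_adjoint_iff]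
    intro x y
    have h1 : ∀ (a : lp (fun _ : Θ => K) 2) (b : K),
        inner ℂ (R.symm a) b = inner ℂ a (R b) := fun a b => by
      rw [← R.inner_map_map, R.apply_symm_apply]
    have h2 : ∀ (a : lp (fun _ : Θ => K) 2) (b : K),
        inner ℂ b (R.symm a) = inner ℂ (R b) a := fun a b => by
      rw [← R.inner_map_map, R.apply_symm_apply]
    refine (h1 _ _).trans (Eq.trans ?_ (h2 _ _).symm)
    rw [lp.inner_eq_tsum, lp.inner_eq_tsum]
    simp [ContinuousLinearMap.adjoint_inner_left]

theorem shiftEndo_apply (R : K ≃ₗᵢ[ℂ] lp (fun _ : Θ => K) 2) (Z : K →L[ℂ] K) (k : K) :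
    shiftEndo R Z k = R.symm (amp Θ Z (R k)) := rfl

theorem inner_shiftEndo (R : K ≃ₗᵢ[ℂ] lp (fun _ : Θ => K) 2) (Z : K →L[ℂ] K) (k k' : K) :
    inner ℂ k (shiftEndo R Z k') = ∑' i, inner ℂ (R k i) (Z (R k' i)) := by
  rw [shiftEndo_apply, ← R.inner_map_map, R.apply_symm_apply, lp.inner_eq_tsum]
  simp

theorem shiftEndo_tendsto (R : K ≃ₗᵢ[ℂ] lp (fun _ : Θ => K) 2) {ι : Type*} (l : Filter ι)
    (Z : ι → K →L[ℂ] K) (Z₀ : K →L[ℂ] K) (C : ℝ) (hC : ∀ᶠ b in l, ‖Z b‖ ≤ C)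
    (h : ∀ ξ η : K, Filter.Tendsto (fun b => inner ℂ ξ (Z b η)) l (nhds (inner ℂ ξ (Z₀ η))))
    (ξ η : K) :
    Filter.Tendsto (fun b => inner ℂ ξ (shiftEndo R (Z b) η)) l
      (nhds (inner ℂ ξ (shiftEndo R Z₀ η))) := by
  simp only [inner_shiftEndo]
  have hs : Summable fun i => C * (‖R ξ i‖ ^ 2 + ‖R η i‖ ^ 2) :=
    ((hasSum_norm_sq (R ξ)).summable.add (hasSum_norm_sq (R η)).summable).mul_left C
  refine tendsto_tsum_of_dominated_convergence hs (fun i => h _ _) ?_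
  filter_upwards [hC] with b hb i
  have hC0 : 0 ≤ C := (norm_nonneg _).trans hb
  calc _ ≤ ‖R ξ i‖ * ‖Z b (R η i)‖ := norm_inner_le_norm _ _
    _ ≤ ‖R ξ i‖ * (C * ‖R η i‖) := by
        gcongr
        exact (Z b).le_of_opNorm_le hb _
    _ = C * (‖R ξ i‖ * ‖R η i‖) := by ring
    _ ≤ _ := by
        gcongr
        nlinarith [sq_nonneg (‖R ξ i‖ - ‖R η i‖), sq_nonneg (‖R ξ i‖), sq_nonneg (‖R η i‖)]

/-- A Hilbert space `K ⊇ G` with a unitary `R : K → ⨁ᵢ K` that extends a given isometry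
`W : G → ⨁ᵢ G`, such that `K` is the smallest closed subspace with `G ⊆ K` that is invariant
under all `R* ∘ ιᵢ`. -/
theorem exists_unitary_extension [DecidableEq Θ] (W : G →ₗᵢ[ℂ] lp (fun _ : Θ => G) 2) :
    ∃ (I : Type (max u v)) (V : G →ₗᵢ[ℂ] lp (fun _ : I => ℂ) 2)
      (R : lp (fun _ : I => ℂ) 2 ≃ₗᵢ[ℂ] lp (fun _ : Θ => lp (fun _ : I => ℂ) 2) 2),
      (∀ g, R (V g) = amp Θ V.toContinuousLinearMap (W g)) ∧
      ∀ M : Submodule ℂ (lp (fun _ : I => ℂ) 2), IsClosed (M : Set (lp (fun _ : I => ℂ) 2)) →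
        (∀ g, V g ∈ M) → (∀ i, ∀ k ∈ M, R.symm (lp.single 2 i k) ∈ M) → M = ⊤ := by
  classical
  obtain ⟨s, a, ha⟩ := exists_hilbertBasis ℂ G
  have hWo : Orthonormal ℂ (fun t : s => W (a t)) := a.orthonormal.comp_linearIsometry W
  obtain ⟨t, f, hst, hf⟩ := hWo.toSubtypeRange.exists_hilbertBasis_extension
  have hfo : Orthonormal ℂ ((↑) : t → lp (fun _ : Θ => G) 2) := hf ▸ f.orthonormal
  obtain ⟨J, hJ⟩ : ∃ J : Set (lp (fun _ : Θ => G) 2),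
      ∀ d, d ∈ J ↔ d ∈ t ∧ d ∉ Set.range fun x : s => W (a x) := ⟨{d | _}, fun d => Iff.rfl⟩
  have hJt : ∀ d : J, d.1 ∈ t := fun d => ((hJ d.1).1 d.2).1
  let b : HilbertBasis (s ⊕ (List Θ × J)) ℂ (lp (fun _ : s ⊕ (List Θ × J) => ℂ) 2) :=
    HilbertBasis.ofRepr (LinearIsometryEquiv.refl ℂ _)
  have hba : Orthonormal ℂ (fun x : s => b (Sum.inl x)) :=
    b.orthonormal.comp _ Sum.inl_injective
  have hfam : OrthogonalFamily ℂ (fun _ : s => ℂ)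
      fun x => LinearIsometry.toSpanSingleton ℂ _ (hba.1 x) := hba.orthogonalFamily
  obtain ⟨V, hVd⟩ : ∃ V : G →ₗᵢ[ℂ] lp (fun _ : s ⊕ (List Θ × J) => ℂ) 2,
    V = hfam.linearIsometry.comp a.repr.toLinearIsometry := ⟨_, rfl⟩
  have hV : ∀ x, V (a x) = b (Sum.inl x) := by
    intro x
    rw [hVd]
    change hfam.linearIsometry (a.repr (a x)) = _
    rw [HilbertBasis.repr_self, OrthogonalFamily.linearIsometry_apply_single]
    simp
  have hVb : ∀ g m, inner ℂ (V g) (b (Sum.inr m)) = 0 := by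
    intro g m
    have : (innerSL ℂ (b (Sum.inr m))) ∘L V.toContinuousLinearMap = 0 := by
      refine ContinuousLinearMap.ext_on (Submodule.dense_iff_topologicalClosure_eq_top.2
        a.dense_span) ?_
      rintro _ ⟨x, rfl⟩
      simp [hV, orthonormal_iff_ite.1 b.orthonormal]
    rw [← inner_conj_symm]
    have h := congrArg (fun T => T g) this
    simpa using congrArg (starRingEnd ℂ) h
  let c : s ⊕ (List Θ × J) → lp (fun _ : Θ => lp (fun _ : s ⊕ (List Θ × J) => ℂ) 2) 2 := fun x => match x with
    | Sum.inl x => amp Θ V.toContinuousLinearMap (W (a x))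
    | Sum.inr ([], d) => amp Θ V.toContinuousLinearMap d.1
    | Sum.inr (i :: L, d) => lp.single 2 i (b (Sum.inr (L, d)))
  have hmix : ∀ (u : lp (fun _ : Θ => G) 2) (i : Θ) (m : List Θ × J),
      inner ℂ (amp Θ V.toContinuousLinearMap u) (lp.single 2 i (b (Sum.inr m))) = 0 := by
    intro u i m
    rw [lp.inner_single_right]
    exact hVb _ _
  have hmix' : ∀ (u : lp (fun _ : Θ => G) 2) (i : Θ) (m : List Θ × J),
      inner ℂ (lp.single 2 i (b (Sum.inr m)) : lp (fun _ : Θ => lp (fun _ : s ⊕ (List Θ × J) => ℂ) 2) 2)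
        (amp Θ V.toContinuousLinearMap u) = 0 := by
    intro u i m
    rw [← inner_conj_symm, hmix, map_zero]
  have hort : ∀ (x : s) (d : J), inner ℂ (W (a x)) d.1 = 0 := by
    intro x d
    have h1 : W (a x) ∈ t := hst ⟨x, rfl⟩
    have h2 := hfo.2 (i := ⟨_, h1⟩) (j := ⟨d.1, hJt d⟩) (by
      intro h
      exact ((hJ d.1).1 d.2).2 ⟨x, congrArg Subtype.val h⟩)
    exact h2
  have hco : Orthonormal ℂ c := by
    rw [orthonormal_iff_ite]
    rintro (x | ⟨_ | ⟨i, L⟩, d⟩) (x' | ⟨_ | ⟨i', L'⟩, d'⟩)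
    · simp only [c, inner_amp_isometry, LinearIsometry.inner_map_map,
        orthonormal_iff_ite.1 a.orthonormal, Sum.inl.injEq]
    · simp only [c, inner_amp_isometry, hort, reduceCtorEq, if_false]
    · simp only [c, hmix, reduceCtorEq, if_false]
    · simp only [c, inner_amp_isometry, reduceCtorEq, if_false]
      rw [← inner_conj_symm, hort, map_zero]
    · simp only [c, inner_amp_isometry]
      have := orthonormal_iff_ite.1 hfo ⟨d.1, hJt d⟩ ⟨d'.1, hJt d'⟩
      refine this.trans ?_
      simp only [Subtype.mk.injEq, Sum.inr.injEq, Prod.mk.injEq, true_and, SetCoe.ext_iff]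
    · simp only [c, hmix]
      simp
    · simp only [c, hmix', reduceCtorEq, if_false]
    · simp only [c, hmix']
      simp
    · simp only [c]
      rw [lp.inner_single_right]
      by_cases h : i' = i
      · subst h
        rw [lp.single_apply_self, orthonormal_iff_ite.1 b.orthonormal]
        simp
      · rw [lp.single_apply_ne _ _ _ h, inner_zero_left, if_neg]
        simp only [Sum.inr.injEq, Prod.mk.injEq, List.cons.injEq]
        tauto
  have hVr : ∀ k : lp (fun _ : s ⊕ (List Θ × J) => ℂ) 2, (∀ m, inner ℂ (b (Sum.inr m)) k = 0) →
      V (ContinuousLinearMap.adjoint V.toContinuousLinearMap k) = k := by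
    intro k hk
    apply b.repr.injective
    ext x
    rw [b.repr_apply_apply, b.repr_apply_apply]
    rcases x with x | m
    · rw [← hV, V.inner_map_map, ContinuousLinearMap.adjoint_inner_right]
      rfl
    · rw [hk, ← inner_conj_symm, hVb, map_zero]
  have hcc : (Submodule.span ℂ (Set.range c))ᗮ = ⊥ := by
    rw [Submodule.eq_bot_iff]
    intro u hu
    have hu' : ∀ x, inner ℂ (c x) u = 0 := fun x =>
      (Submodule.mem_orthogonal _ _).1 hu _ (Submodule.subset_span ⟨x, rfl⟩)
    have h1 : ∀ i, V (ContinuousLinearMap.adjoint V.toContinuousLinearMap (u i)) = u i := by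
      intro i
      apply hVr
      rintro ⟨L, d⟩
      have := hu' (Sum.inr (i :: L, d))
      simpa only [c, lp.inner_single_left] using this
    let u' : lp (fun _ : Θ => G) 2 :=
      amp Θ (ContinuousLinearMap.adjoint V.toContinuousLinearMap) u
    have h2 : u = amp Θ V.toContinuousLinearMap u' := by
      ext i : 2
      exact (h1 i).symm
    have h3 : u' = 0 := by
      apply f.repr.injective
      rw [map_zero]
      ext d
      rw [f.repr_apply_apply, hf]
      by_cases hd : d.1 ∈ Set.range fun x : s => W (a x)
      · obtain ⟨x, hx⟩ := hd
        have := hu' (Sum.inl x)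
        simp only [c] at this
        rw [h2, inner_amp_isometry] at this
        rw [← hx]
        exact this
      · have := hu' (Sum.inr ([], ⟨d.1, (hJ _).2 ⟨d.2, hd⟩⟩))
        simp only [c] at this
        rw [h2, inner_amp_isometry] at this
        exact this
    rw [h2, h3, map_zero]
  let cb : HilbertBasis (s ⊕ (List Θ × J)) ℂ (lp (fun _ : Θ => lp (fun _ : s ⊕ (List Θ × J) => ℂ) 2) 2) := HilbertBasis.mkOfOrthogonalEqBot hco hcc
  have hcb : ∀ x, cb x = c x := fun x =>
    congrFun (HilbertBasis.coe_mkOfOrthogonalEqBot hco hcc) x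
  let R : lp (fun _ : s ⊕ (List Θ × J) => ℂ) 2 ≃ₗᵢ[ℂ] lp (fun _ : Θ => lp (fun _ : s ⊕ (List Θ × J) => ℂ) 2) 2 := b.repr.trans cb.repr.symm
  have hR : ∀ x, R (b x) = c x := by
    intro x
    simp only [R, LinearIsometryEquiv.trans_apply, HilbertBasis.repr_self,
      HilbertBasis.repr_symm_single]
    exact hcb x
  have hRV : ∀ g, R (V g) = amp Θ V.toContinuousLinearMap (W g) := by
    intro g
    have : R.toContinuousLinearEquiv.toContinuousLinearMap ∘L V.toContinuousLinearMap =
        amp Θ V.toContinuousLinearMap ∘L W.toContinuousLinearMap := by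
      refine ContinuousLinearMap.ext_on (Submodule.dense_iff_topologicalClosure_eq_top.2
        a.dense_span) ?_
      rintro _ ⟨x, rfl⟩
      have h := hR (Sum.inl x)
      rw [← hV] at h
      exact h
    exact congrArg (fun T => T g) this
  refine ⟨s ⊕ (List Θ × J), V, R, hRV, ?_⟩
  intro M hM hVM hSM
  have hsum : ∀ u : lp (fun _ : Θ => lp (fun _ : s ⊕ (List Θ × J) => ℂ) 2) 2, (∀ i, u i ∈ M) → R.symm u ∈ M := by
    intro u hu
    have h := (lp.hasSum_single (by norm_num) u).mapL
      R.symm.toContinuousLinearEquiv.toContinuousLinearMap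
    exact hM.mem_of_tendsto h (Filter.Eventually.of_forall fun S =>
      M.sum_mem fun i _ => hSM i _ (hu i))
  have hbM : ∀ x, b x ∈ M := by
    rintro (x | ⟨L, d⟩)
    · rw [← hV]; exact hVM _
    · induction L with
      | nil =>
        have h := hR (Sum.inr ([], d))
        rw [← R.symm_apply_apply (b (Sum.inr ([], d))), h]
        exact hsum _ fun i => hVM _
      | cons i L ih =>
        have h := hR (Sum.inr (i :: L, d))
        rw [← R.symm_apply_apply (b (Sum.inr (i :: L, d))), h]
        exact hSM _ _ ih
  rw [eq_top_iff, ← b.dense_span]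
  refine Submodule.topologicalClosure_minimal _ (Submodule.span_le.2 ?_) hM
  rintro _ ⟨x, rfl⟩
  exact hbM x

variable (K) in
/-- The von Neumann algebra of all bounded operators. -/
def fullAlgebra : VonNeumannAlgebra K where
  toStarSubalgebra := ⊤
  centralizer_centralizer' := by
    refine Set.eq_univ_of_forall fun x => ?_
    rw [Set.mem_centralizer_iff]
    intro m hm
    exact (Set.mem_centralizer_iff.1 hm x (Set.mem_univ x)).symm

/-- A `*`-endomorphism of `B(K)` as one of the von Neumann algebra `B(K)`. -/
def fullEndo (θ : (K →L[ℂ] K) →⋆ₐ[ℂ] (K →L[ℂ] K)) :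
    (fullAlgebra K).toStarSubalgebra →⋆ₐ[ℂ] (fullAlgebra K).toStarSubalgebra :=
  (θ.comp (fullAlgebra K).toStarSubalgebra.subtype).codRestrict _ fun _ => trivial

theorem fullEndo_iterate (θ : (K →L[ℂ] K) →⋆ₐ[ℂ] (K →L[ℂ] K)) (n : ℕ)
    (z : (fullAlgebra K).toStarSubalgebra) :
    ((fullEndo θ)^[n] z : K →L[ℂ] K) = θ^[n] (z : K →L[ℂ] K) := by
  induction n generalizing z with
  | zero => rfl
  | succ n ih => exact ih _

theorem exists_minimalDilation_of_isometry [DecidableEq Θ]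
    (τ : (G →L[ℂ] G) → (G →L[ℂ] G)) (W : G →ₗᵢ[ℂ] lp (fun _ : Θ => G) 2)
    (hτ : ∀ x g g', inner ℂ g (τ x g') = ∑' i, inner ℂ (W g i) (x (W g' i)))
    (g₀ : G) (hg₀ : ‖g₀‖ = 1)
    (hsep : ∀ i, ∃ h k : G, ∀ j, inner ℂ h (W k j) = if j = i then 1 else 0) :
    ∃ I : Type (max u v), Nonempty (MinimalDilation (lp (fun _ : I => ℂ) 2) τ) := by
  obtain ⟨I, V, R, hRV, hmin⟩ := exists_unitary_extension W
  refine ⟨I, ?_⟩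
  set K := lp (fun _ : I => ℂ) 2
  let θ := shiftEndo R
  have hVV : ∀ g, ContinuousLinearMap.adjoint V.toContinuousLinearMap (V g) = g := by
    intro g
    refine ext_inner_left ℂ fun h => ?_
    rw [ContinuousLinearMap.adjoint_inner_right]
    exact V.inner_map_map h g
  have hcompress : ∀ Z, compress V (θ Z) = τ (compress V Z) := by
    intro Z
    ext g'
    refine ext_inner_left ℂ fun g => ?_
    rw [hτ, compress, ContinuousLinearMap.comp_apply, ContinuousLinearMap.adjoint_inner_right]
    refine (inner_shiftEndo R Z (V g) (V g')).trans ?_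
    refine tsum_congr fun i => ?_
    rw [hRV, hRV, compress, ContinuousLinearMap.comp_apply,
      ContinuousLinearMap.adjoint_inner_right]
    rfl
  have hcE : ∀ x, compress V (cornerEmbed V x) = x := by
    intro x
    ext g
    simp only [compress, cornerEmbed, ContinuousLinearMap.comp_apply]
    erw [hVV, hVV]
  have hdil : ∀ n x, compress V (θ^[n] (cornerEmbed V x)) = τ^[n] x := by
    intro n x
    induction n with
    | zero => exact hcE x
    | succ n ih => rw [Function.iterate_succ_apply', Function.iterate_succ_apply', hcompress, ih]
  let S : Set K := {k : K | ∃ (L : List (ℕ × (G →L[ℂ] G))) (g : G),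
    k = (L.map fun q => θ^[q.1] (cornerEmbed V q.2)).prod (V g)}
  let M : Submodule ℂ K := (Submodule.span ℂ S).topologicalClosure
  have hshift : ∀ i (Z : K →L[ℂ] K) (k : K),
      R.symm (lp.single 2 i (Z k)) = θ Z (R.symm (lp.single 2 i k)) := by
    intro i Z k
    change _ = R.symm (amp Θ Z (R (R.symm _)))
    rw [R.apply_symm_apply, amp_single]
  have hV0 : ∀ i g, ∃ (x : G →L[ℂ] G) (k : G),
      R.symm (lp.single 2 i (V g)) = θ (cornerEmbed V x) (V k) := by
    intro i g
    obtain ⟨h, k, hk⟩ := hsep i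
    refine ⟨(innerSL ℂ h).smulRight g, k, ?_⟩
    change _ = R.symm (amp Θ _ (R (V k)))
    congr 1
    rw [hRV]
    ext j : 2
    rw [amp_apply, amp_apply]
    change _ = V ((innerSL ℂ h).smulRight g (ContinuousLinearMap.adjoint
      V.toContinuousLinearMap (V (W k j))))
    rw [hVV]
    simp only [ContinuousLinearMap.smulRight_apply, innerSL_apply_apply, hk]
    by_cases hj : j = i
    · subst hj; simp
    · simp [hj]
  have hSS : ∀ i, ∀ k ∈ S, R.symm (lp.single 2 i k) ∈ S := by
    rintro i _ ⟨L, g, rfl⟩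
    induction L with
    | nil =>
      obtain ⟨x, k, hx⟩ := hV0 i g
      refine ⟨[(1, x)], k, ?_⟩
      simpa using hx
    | cons q L ih =>
      obtain ⟨L', g', h'⟩ := ih
      refine ⟨(q.1 + 1, q.2) :: L', g', ?_⟩
      rw [List.map_cons, List.prod_cons, mul_apply_eq_comp, hshift, h', List.map_cons,
        List.prod_cons, mul_apply_eq_comp]
      simp only [Function.iterate_succ_apply']
  have hM : M = ⊤ := by
    refine hmin M (Submodule.isClosed_topologicalClosure _) ?_ ?_
    · intro g
      exact Submodule.le_topologicalClosure _ (Submodule.subset_span ⟨[], g, by simp⟩)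
    · intro i
      let T : K →L[ℂ] K := R.symm.toContinuousLinearEquiv.toContinuousLinearMap ∘L
        lp.singleContinuousLinearMap ℂ (fun _ : Θ => K) 2 i
      have hle : M ≤ M.comap T.toLinearMap := by
        refine Submodule.topologicalClosure_minimal _ (Submodule.span_le.2 ?_) ?_
        · intro k hk
          exact Submodule.le_topologicalClosure _ (Submodule.subset_span (hSS i k hk))
        · exact (Submodule.isClosed_topologicalClosure _).preimage T.continuous
      exact fun k hk => hle hk
  have hdense : Dense (Submodule.span ℂ S : Set K) :=
    Submodule.dense_iff_topologicalClosure_eq_top.2 hM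
  refine ⟨⟨V, fullAlgebra K, fullEndo θ, ?_, fun _ => trivial, ?_, ?_, ?_⟩⟩
  · intro C l a hC h
    exact shiftEndo_tendsto R l _ _ C hC h
  · intro n x
    rw [fullEndo_iterate]
    exact hdil n x
  · simp only [fullEndo_iterate]
    refine Set.eq_univ_of_forall fun y => ?_
    rw [Set.mem_centralizer_iff]
    intro Z hZ
    rw [Set.mem_centralizer_iff] at hZ
    have hZc : ∀ n x k, θ^[n] (cornerEmbed V x) (Z k) = Z (θ^[n] (cornerEmbed V x) k) :=
      fun n x k => congrArg (fun T : K →L[ℂ] K => T k) (hZ _ ⟨n, x, rfl⟩)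
    have hZV : ∀ g, Z (V g) = inner ℂ (V g₀) (Z (V g₀)) • V g := by
      intro g
      have h := hZc 0 ((innerSL ℂ g₀).smulRight g) (V g₀)
      have h1 : ∀ k, cornerEmbed V ((innerSL ℂ g₀).smulRight g) k =
          inner ℂ (V g₀) k • V g := by
        intro k
        change V ((innerSL ℂ g₀).smulRight g (ContinuousLinearMap.adjoint
          V.toContinuousLinearMap k)) = _
        rw [ContinuousLinearMap.smulRight_apply, innerSL_apply_apply,
          ContinuousLinearMap.adjoint_inner_right, map_smul]
        rfl
      rw [Function.iterate_zero, id, h1, h1, V.inner_map_map, inner_self_eq_norm_sq_to_K, hg₀] at h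
      simpa using h.symm
    have hZs : Z = inner ℂ (V g₀) (Z (V g₀)) • (1 : K →L[ℂ] K) := by
      refine ContinuousLinearMap.ext_on hdense ?_
      rintro _ ⟨L, g, rfl⟩
      induction L with
      | nil => simpa using hZV g
      | cons q L ih =>
        rw [List.map_cons, List.prod_cons, mul_apply_eq_comp, ← hZc, ih]
        simp
    rw [hZs]
    simp
  · simp only [fullEndo_iterate]
    exact hM

theorem exists_minimalDilation_fockMap {H : Type u} [NormedAddCommGroup H]
    [InnerProductSpace ℂ H] (e : HilbertBasis Θ ℂ H) (ω : Θ → ℝ) (hpos : ∀ i, 0 < ω i)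
    (hsum : HasSum ω 1) :
    ∃ I : Type (max u v),
      Nonempty (MinimalDilation (lp (fun _ : I => ℂ) 2) (fockMap e ω)) := by
  classical
  have hs : ∀ η : FockSpace H,
      HasSum (fun i => ‖(Real.sqrt (ω i) : ℂ) • leftCreation (e i) η‖ ^ 2) (‖η‖ ^ 2) := by
    intro η
    have h := hsum.mul_right (‖η‖ ^ 2)
    rw [one_mul] at h
    refine h.congr_fun fun i => ?_
    rw [norm_smul, norm_leftCreation_apply, e.orthonormal.1 i, one_mul, mul_pow,
      Complex.norm_real, Real.norm_eq_abs, sq_abs, Real.sq_sqrt (hpos i).le]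
  have hmem : ∀ η : FockSpace H,
      Memℓp (fun i => (Real.sqrt (ω i) : ℂ) • leftCreation (e i) η : Θ → FockSpace H) 2 := by
    intro η
    apply memℓp_gen
    simpa using (hs η).summable
  let W : FockSpace H →ₗᵢ[ℂ] lp (fun _ : Θ => FockSpace H) 2 :=
    { toFun := fun η => ⟨_, hmem η⟩
      map_add' := fun η η' => by
        ext i : 2
        exact (congrArg _ (map_add (leftCreation (e i)) η η')).trans (smul_add _ _ _)
      map_smul' := fun c η => by
        ext i : 2
        exact (congrArg _ (map_smul (leftCreation (e i)) c η)).trans (smul_comm _ _ _)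
      norm_map' := fun η => by
        have := (hasSum_norm_sq (⟨_, hmem η⟩ : lp (fun _ : Θ => FockSpace H) 2)).unique (hs η)
        exact (pow_left_inj₀ (norm_nonneg _) (norm_nonneg _) two_ne_zero).1 this }
  have hvac : inner ℂ (vacuum H) (vacuum H) = (1 : ℂ) := by
    rw [vacuum, pureVector, lp.inner_single_left]
    rw [lp.single_apply_self]
    change inner ℂ (EuclideanSpace.single PUnit.unit (1 : ℂ))
      (EuclideanSpace.single PUnit.unit (1 : ℂ)) = (1 : ℂ)
    simp
  have hll : ∀ i j (η η' : FockSpace H), inner ℂ (leftCreation (e i) η) (leftCreation (e j) η') =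
      (if j = i then 1 else 0) * inner ℂ η η' := by
    intro i j η η'
    have h1 := lp.hasSum_inner (𝕜 := ℂ) (leftCreation (e i) η) (leftCreation (e j) η')
    have h2 := (lp.hasSum_inner (𝕜 := ℂ) η η').mul_left (inner ℂ (e i) (e j))
    rw [← hasSum_nat_add_iff' 1] at h1
    have h3 := h1.unique (h2.congr_fun fun n => by
      rw [leftCreation_apply_succ, leftCreation_apply_succ, inner_tensorCons])
    rw [Finset.sum_range_one, leftCreation_apply_zero, inner_zero_left, sub_zero,
      orthonormal_iff_ite.1 e.orthonormal] at h3
    rw [h3]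
    simp only [eq_comm]
  refine exists_minimalDilation_of_isometry _ W ?_ (vacuum H) ?_ ?_
  · intro x g g'
    have h := (summable_fockMap e hsum.summable x).hasSum
    have h2 := (h.mapL (ContinuousLinearMap.apply ℂ (FockSpace H) g')).mapL (innerSL ℂ g)
    refine h2.tsum_eq.symm.trans (tsum_congr fun i => ?_)
    change inner ℂ g ((ω i : ℂ) • ContinuousLinearMap.adjoint (leftCreation (e i))
      (x (leftCreation (e i) g'))) = inner ℂ ((Real.sqrt (ω i) : ℂ) • leftCreation (e i) g)
        (x ((Real.sqrt (ω i) : ℂ) • leftCreation (e i) g'))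
    rw [map_smul, inner_smul_left, inner_smul_right, inner_smul_right,
      ContinuousLinearMap.adjoint_inner_right, Complex.conj_ofReal, ← mul_assoc,
      ← Complex.ofReal_mul, Real.mul_self_sqrt (hpos i).le]
  · have h := inner_self_eq_norm_sq_to_K (𝕜 := ℂ) (vacuum H)
    rw [hvac] at h
    have h' : ‖vacuum H‖ ^ 2 = 1 := Complex.ofReal_injective (by simpa using h.symm)
    exact (pow_eq_one_iff_of_nonneg (norm_nonneg _) two_ne_zero).1 h'
  · intro i
    refine ⟨((Real.sqrt (ω i) : ℂ)⁻¹) • leftCreation (e i) (vacuum H), vacuum H, fun j => ?_⟩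
    change inner ℂ _ ((Real.sqrt (ω j) : ℂ) • leftCreation (e j) (vacuum H)) = _
    rw [inner_smul_left, inner_smul_right, hll, hvac]
    by_cases hj : j = i
    · subst hj
      have : (Real.sqrt (ω j) : ℂ) ≠ 0 :=
        Complex.ofReal_ne_zero.2 (Real.sqrt_pos.2 (hpos j)).ne'
      simp [Complex.conj_ofReal, this]
    · simp [hj]

end Existence

end FullFock

end

open FullFock

/-! Write `P` for `P_ω`, `pₙ = θⁿ(p)` and `R_j` for the right creation operator `η ↦ η ⊗ e_j`.

The test elements are the `R_j`. They commute with every `l_i`, so `P(xR_j) = P(x)R_j`, and in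
particular they are fixed by `P`. They lift to fixed points `W_j` of `θ`, and an element of the
relative commutant lifts to some `z` in `P(θ)` commuting with every `W_j` and every `W_j*`.

Products with `W_j` can be computed on the Fock space. If `z = θⁿ(uₙ)` and `w = θⁿ(vₙ)` for all `n`,
then `T(zw)` is the weak limit of `Pⁿ(T(uₙ)T(vₙ))`, because `pₙ → 1` strongly
(`tendsto_inner_compression_mul`). This gives three rules: `T(zW_j) = T(z)R_j`; on a row `e_{Jk}`,
left multiplication by `W_j` strips the last letter `k` and gives `0` unless `k = j`; and `⟨Ω, T(W_j
θ(y)) g⟩ = ω_j ⟨Ω, T(y) l_j g⟩`.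

Let `z = θ(y)`. Commutation and the rules give `⟨Ω, T(z)e_{Ij}⟩ = ω_j ⟨Ω, T(y)e_{jI}⟩`. Here `y` has
the same norm and the same commutation as `z`, and the word has only been rotated, so the step can
be repeated forever. As there are at least two letters, `sup ω_j < 1`, and the vacuum row vanishes
off the diagonal. The adjoint handles the vacuum column, and stripping common last letters reduces
every other matrix entry to these two cases.

The general theory underneath rests on recurrence: a contraction returns each vector of its
peripheral space arbitrarily close to itself. Hence `θ` is an isometric bijection of `P(θ)`, so
backward orbits exist, and `T` is isometric on `P(θ)`. -/

namespace FullFock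

open Filter Topology

/-! ### Recurrence on the peripheral space of a contraction -/

section Recurrence

variable {A : Type*} [NormedRing A] [NormedAlgebra ℂ A]

theorem mem_peripheralSpace_of_eigen {f : A → A} {c : ℂ} (hc : ‖c‖ = 1) {x : A}
    (h : f x = c • x) : x ∈ peripheralSpace f :=
  Submodule.le_topologicalClosure _ (Submodule.subset_span ⟨c, hc, h⟩)

theorem isClosed_peripheralSpace (f : A → A) : IsClosed (peripheralSpace f : Set A) :=
  Submodule.isClosed_topologicalClosure _

/-- A closed subspace that contains all peripheral eigenvectors contains the peripheral space. -/
theorem peripheralSpace_le {f : A → A} {M : Submodule ℂ A} (hM : IsClosed (M : Set A))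
    (h : ∀ (c : ℂ) (x : A), ‖c‖ = 1 → f x = c • x → x ∈ M) : peripheralSpace f ≤ M :=
  Submodule.topologicalClosure_minimal _
    (Submodule.span_le.2 fun x ⟨c, hc, hx⟩ => h c x hc hx) hM

/-- On the span of the peripheral eigenvectors, the orbit of a vector is a continuous function of
the powers of one element of a compact group. -/
theorem exists_orbit_eq {f : A →ₗ[ℂ] A} {x : A}
    (hx : x ∈ Submodule.span ℂ {x : A | ∃ c : ℂ, ‖c‖ = 1 ∧ f x = c • x}) :
    ∃ Φ : (Circle → Circle) → A, Continuous Φ ∧ ∀ k : ℕ, f^[k] x = Φ (id ^ k) := by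
  induction hx using Submodule.span_induction with
  | mem x hx =>
    obtain ⟨c, hc, h⟩ := hx
    obtain ⟨u, rfl⟩ : ∃ u : Circle, (u : ℂ) = c := ⟨⟨c, mem_sphere_zero_iff_norm.2 hc⟩, rfl⟩
    -- Evaluating at the eigenvalue `u` turns `id ^ k` into `u ^ k`. Indexing by the whole circle
    -- lets one group element serve all eigenvalues at once.
    refine ⟨fun g => (g u : ℂ) • x, by fun_prop, fun k => ?_⟩
    change f^[k] x = ((u ^ k : Circle) : ℂ) • x
    rw [Circle.coe_pow]
    induction k with
    | zero => simp
    | succ k ih => rw [Function.iterate_succ_apply', ih, map_smul, h, smul_smul, pow_succ]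
  | zero => exact ⟨fun _ => 0, continuous_const, fun k => by simp⟩
  | add x y _ _ hx hy =>
    obtain ⟨Φ, hΦ, h⟩ := hx
    obtain ⟨Ψ, hΨ, h'⟩ := hy
    refine ⟨fun g => Φ g + Ψ g, hΦ.add hΨ, fun k => ?_⟩
    exact (iterate_map_add f k x y).trans (congrArg₂ _ (h k) (h' k))
  | smul a x _ hx =>
    obtain ⟨Φ, hΦ, h⟩ := hx
    refine ⟨fun g => a • Φ g, hΦ.const_smul a, fun k => ?_⟩
    refine Eq.trans ?_ (congrArg _ (h k))
    rw [← Module.End.pow_apply, ← Module.End.pow_apply, map_smul]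

theorem norm_iterate_le {f : A →ₗ[ℂ] A} (hf : ∀ a, ‖f a‖ ≤ ‖a‖) (n : ℕ) (a : A) :
    ‖f^[n] a‖ ≤ ‖a‖ := by
  induction n with
  | zero => rfl
  | succ n ih => rw [Function.iterate_succ_apply']; exact (hf _).trans ih

/-- Every vector of the peripheral space of a contraction is recurrent. -/
theorem frequently_norm_iterate_sub_lt {f : A →ₗ[ℂ] A} (hf : ∀ a, ‖f a‖ ≤ ‖a‖) {x : A}
    (hx : x ∈ peripheralSpace f) {ε : ℝ} (hε : 0 < ε) : ∃ᶠ n in atTop, ‖f^[n] x - x‖ < ε := by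
  obtain ⟨y, hy, hxy⟩ := Metric.mem_closure_iff.1 (show x ∈ closure _ from hx) (ε / 3) (by positivity)
  obtain ⟨Φ, hΦ, h⟩ := exists_orbit_eq hy
  -- The group `Circle → Circle` is compact, so the powers of any element accumulate at `1`.
  have h1 : MapClusterPt (Φ 1) atTop (Φ ∘ ((id : Circle → Circle) ^ ·)) :=
    (mapClusterPt_one_atTop_pow (id : Circle → Circle)).tendsto_comp hΦ.continuousAt
  have h2 : Φ 1 = y := by simpa using (h 0).symm
  rw [h2] at h1
  refine (h1.frequently (Metric.ball_mem_nhds y (by positivity : 0 < ε / 3))).mono fun n hn => ?_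
  have hn' : ‖f^[n] y - y‖ < ε / 3 := by
    rw [h, ← dist_eq_norm]; exact hn
  have h3 : ‖f^[n] x - f^[n] y‖ ≤ ‖x - y‖ := by
    rw [← Module.End.pow_apply, ← Module.End.pow_apply, ← map_sub, Module.End.pow_apply]
    exact norm_iterate_le hf n _
  rw [dist_eq_norm] at hxy
  calc ‖f^[n] x - x‖ = ‖(f^[n] x - f^[n] y) + (f^[n] y - y) - (x - y)‖ := by congr 1; abel
    _ ≤ ‖f^[n] x - f^[n] y‖ + ‖f^[n] y - y‖ + ‖x - y‖ :=
      (norm_sub_le _ _).trans (add_le_add (norm_add_le _ _) le_rfl)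
    _ < ε := by linarith

/-- Any norm lost in the first step could never be regained, yet some later iterate comes back
within `ε` of `x`. -/
theorem norm_map_of_mem_peripheralSpace {f : A →ₗ[ℂ] A} (hf : ∀ a, ‖f a‖ ≤ ‖a‖) {x : A}
    (hx : x ∈ peripheralSpace f) : ‖f x‖ = ‖x‖ := by
  refine le_antisymm (hf x) (le_of_forall_pos_lt_add fun ε hε => ?_)
  obtain ⟨n, hn1, hn⟩ :=
    frequently_atTop.1 (frequently_norm_iterate_sub_lt hf hx hε) 1
  obtain ⟨m, rfl⟩ := Nat.exists_eq_add_of_le' hn1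
  have h1 : ‖f^[m + 1] x‖ ≤ ‖f x‖ := norm_iterate_le hf m (f x)
  have h2 := norm_le_norm_add_norm_sub (f^[m + 1] x) x
  linarith

theorem map_mem_peripheralSpace {f : A →ₗ[ℂ] A} (hf : Continuous f) {x : A}
    (hx : x ∈ peripheralSpace f) : f x ∈ peripheralSpace f := by
  refine peripheralSpace_le (M := (peripheralSpace f).comap f)
    ((isClosed_peripheralSpace f).preimage hf) (fun c y hc hy => ?_) hx
  rw [Submodule.mem_comap, hy]
  exact Submodule.smul_mem _ _ (mem_peripheralSpace_of_eigen hc hy)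

/-- If a linear map is isometric on a closed subspace `M`, then the image of `M` is closed. -/
theorem isClosed_map_of_isometric {B : Type*} [NormedAddCommGroup B] [NormedSpace ℂ B]
    [CompleteSpace A] (g : A →ₗ[ℂ] B) {M : Submodule ℂ A} (hM : IsClosed (M : Set A))
    (hg : ∀ x ∈ M, ‖g x‖ = ‖x‖) : IsClosed (M.map g : Set B) := by
  have : CompleteSpace M := hM.completeSpace_coe
  let φ : M →ₗᵢ[ℂ] B := ⟨g ∘ₗ M.subtype, fun x => hg x x.2⟩
  have h : (M.map g : Set B) = Set.range φ := by
    ext b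
    constructor
    · rintro ⟨x, hx, rfl⟩; exact ⟨⟨x, hx⟩, rfl⟩
    · rintro ⟨x, rfl⟩; exact ⟨x, x.2, rfl⟩
  rw [h]
  exact φ.isometry.isClosedEmbedding.isClosed_range

/-- A contraction maps its peripheral space onto itself. -/
theorem exists_map_eq_of_mem_peripheralSpace [CompleteSpace A] {f : A →ₗ[ℂ] A}
    (hf : ∀ a, ‖f a‖ ≤ ‖a‖) {x : A}
    (hx : x ∈ peripheralSpace f) : ∃ y ∈ peripheralSpace f, f y = x := by
  -- The image is closed since `f` is isometric on the peripheral space, and it contains each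
  -- eigenvector `y = f (c⁻¹ • y)`.
  have h : peripheralSpace f ≤ (peripheralSpace f).map f := by
    refine peripheralSpace_le (isClosed_map_of_isometric f (isClosed_peripheralSpace f)
      fun x hx => norm_map_of_mem_peripheralSpace hf hx) fun c y hc hy => ?_
    refine ⟨c⁻¹ • y, Submodule.smul_mem _ _ (mem_peripheralSpace_of_eigen hc hy), ?_⟩
    have : c ≠ 0 := by rintro rfl; simp at hc
    rw [map_smul, hy, smul_smul, inv_mul_cancel₀ this, one_smul]
  exact h hx

end Recurrence

noncomputable section

/-! ### The projections `θⁿ(p)` and the compression map -/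

section DilationTheory

variable {G : Type u} [NormedAddCommGroup G] [InnerProductSpace ℂ G] [CompleteSpace G]
variable {K : Type v} [NormedAddCommGroup K] [InnerProductSpace ℂ K] [CompleteSpace K]

/-- Norm closedness makes the algebra a C*-algebra, so that its `*`-endomorphisms are contractive.
-/
instance isClosed_vonNeumannAlgebra (B : VonNeumannAlgebra K) :
    IsClosed (B.toStarSubalgebra : Set (K →L[ℂ] K)) := by
  rw [VonNeumannAlgebra.coe_toStarSubalgebra, ← B.centralizer_centralizer]
  exact Set.isClosed_centralizer _

theorem norm_starSubalgebra_endo_le {A : Type*} [CStarAlgebra A] (S : StarSubalgebra ℂ A)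
    [IsClosed (S : Set A)] (f : S →⋆ₐ[ℂ] S) (a : S) : ‖(f a : A)‖ ≤ ‖(a : A)‖ :=
  NonUnitalStarAlgHom.norm_apply_le f a

theorem adjoint_apply_isometry (V : G →ₗᵢ[ℂ] K) (g : G) :
    ContinuousLinearMap.adjoint V.toContinuousLinearMap (V g) = g := by
  refine ext_inner_left ℂ fun h => ?_
  rw [ContinuousLinearMap.adjoint_inner_right]
  exact V.inner_map_map h g

theorem inner_compress (V : G →ₗᵢ[ℂ] K) (z : K →L[ℂ] K) (g g' : G) :
    inner ℂ g (compress V z g') = inner ℂ (V g) (z (V g')) := by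
  rw [compress, ContinuousLinearMap.comp_apply, ContinuousLinearMap.adjoint_inner_right]
  rfl

theorem compress_cornerEmbed (V : G →ₗᵢ[ℂ] K) (x : G →L[ℂ] G) :
    compress V (cornerEmbed V x) = x := by
  ext g
  change ContinuousLinearMap.adjoint V.toContinuousLinearMap (V (x
    (ContinuousLinearMap.adjoint V.toContinuousLinearMap (V g)))) = x g
  rw [adjoint_apply_isometry, adjoint_apply_isometry]

theorem cornerEmbed_mul (V : G →ₗᵢ[ℂ] K) (x y : G →L[ℂ] G) :
    cornerEmbed V x * cornerEmbed V y = cornerEmbed V (x * y) := by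
  ext k
  change V (x (ContinuousLinearMap.adjoint V.toContinuousLinearMap (V (y _)))) = V (x (y _))
  rw [adjoint_apply_isometry]

theorem norm_compress_le (V : G →ₗᵢ[ℂ] K) (z : K →L[ℂ] K) : ‖compress V z‖ ≤ ‖z‖ := by
  have h := V.norm_toContinuousLinearMap_le
  have h' : ‖ContinuousLinearMap.adjoint V.toContinuousLinearMap‖ ≤ 1 := by
    rwa [LinearIsometryEquiv.norm_map]
  calc ‖compress V z‖ ≤ ‖ContinuousLinearMap.adjoint V.toContinuousLinearMap‖ *
        (‖z‖ * ‖V.toContinuousLinearMap‖) :=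
      (ContinuousLinearMap.opNorm_comp_le _ _).trans
        (mul_le_mul_of_nonneg_left (ContinuousLinearMap.opNorm_comp_le _ _) (norm_nonneg _))
    _ ≤ 1 * (‖z‖ * 1) := by gcongr
    _ = ‖z‖ := by ring

theorem norm_cornerEmbed_le (V : G →ₗᵢ[ℂ] K) (x : G →L[ℂ] G) : ‖cornerEmbed V x‖ ≤ ‖x‖ := by
  have h := V.norm_toContinuousLinearMap_le
  have h' : ‖ContinuousLinearMap.adjoint V.toContinuousLinearMap‖ ≤ 1 := by
    rwa [LinearIsometryEquiv.norm_map]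
  calc ‖cornerEmbed V x‖ ≤ ‖V.toContinuousLinearMap‖ *
        (‖x‖ * ‖ContinuousLinearMap.adjoint V.toContinuousLinearMap‖) :=
      (ContinuousLinearMap.opNorm_comp_le _ _).trans
        (mul_le_mul_of_nonneg_left (ContinuousLinearMap.opNorm_comp_le _ _) (norm_nonneg _))
    _ ≤ 1 * (‖x‖ * 1) := by gcongr
    _ = ‖x‖ := by ring

namespace MinimalDilation

variable {τ : (G →L[ℂ] G) → (G →L[ℂ] G)} (D : MinimalDilation K τ)

/-- The corner embedding as a map into the von Neumann algebra. -/
def emb (x : G →L[ℂ] G) : D.alg.toStarSubalgebra := ⟨cornerEmbed D.incl x, D.corner_mem x⟩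

/-- The projections `θⁿ(p)`. -/
def proj (n : ℕ) : D.alg.toStarSubalgebra := D.endo^[n] (D.emb 1)

/-- The compression as a linear map. -/
def compressionLin : D.alg.toStarSubalgebra →ₗ[ℂ] (G →L[ℂ] G) where
  toFun := D.compression
  map_add' z w := by
    ext g
    exact map_add (ContinuousLinearMap.adjoint D.incl.toContinuousLinearMap) _ _
  map_smul' c z := by
    ext g
    exact map_smul (ContinuousLinearMap.adjoint D.incl.toContinuousLinearMap) c _

theorem compressionLin_apply (z : D.alg.toStarSubalgebra) :
    D.compressionLin z = D.compression z := rfl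

theorem norm_compression_le (z : D.alg.toStarSubalgebra) : ‖D.compression z‖ ≤ ‖z‖ :=
  norm_compress_le _ _

theorem norm_emb_le (x : G →L[ℂ] G) : ‖D.emb x‖ ≤ ‖x‖ := norm_cornerEmbed_le _ _

theorem continuous_compression : Continuous D.compression :=
  AddMonoidHomClass.continuous_of_bound D.compressionLin 1 fun z => by
    rw [one_mul]; exact D.norm_compression_le z

theorem compression_emb (x : G →L[ℂ] G) : D.compression (D.emb x) = x :=
  compress_cornerEmbed _ _

theorem emb_mul (x y : G →L[ℂ] G) : D.emb x * D.emb y = D.emb (x * y) :=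
  Subtype.ext (cornerEmbed_mul _ _ _)

theorem emb_compression (z : D.alg.toStarSubalgebra) :
    D.emb (D.compression z) = D.emb 1 * z * D.emb 1 := rfl

theorem emb_smul (c : ℂ) (x : G →L[ℂ] G) : D.emb (c • x) = c • D.emb x := by
  refine Subtype.ext ?_
  ext k
  exact map_smul D.incl c _

theorem star_emb_one : star (D.emb 1) = D.emb 1 := by
  refine Subtype.ext ?_
  change ContinuousLinearMap.adjoint (D.incl.toContinuousLinearMap ∘L 1 ∘L
    ContinuousLinearMap.adjoint D.incl.toContinuousLinearMap) = _
  rw [ContinuousLinearMap.adjoint_comp, ContinuousLinearMap.adjoint_comp,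
    ContinuousLinearMap.adjoint_adjoint]
  rw [show ContinuousLinearMap.adjoint (1 : G →L[ℂ] G) = 1 from star_one (G →L[ℂ] G)]
  rfl

theorem compression_star (z : D.alg.toStarSubalgebra) :
    D.compression (star z) = star (D.compression z) := by
  change compress _ _ = ContinuousLinearMap.adjoint (_ ∘L _ ∘L _)
  rw [ContinuousLinearMap.adjoint_comp, ContinuousLinearMap.adjoint_comp,
    ContinuousLinearMap.adjoint_adjoint]
  rfl

theorem compression_one : D.compression 1 = 1 := by
  ext g
  exact adjoint_apply_isometry D.incl g

theorem norm_endo_le (z : D.alg.toStarSubalgebra) : ‖D.endo z‖ ≤ ‖z‖ := by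
  have h : ‖(D.endo z : K →L[ℂ] K)‖ ≤ ‖(z : K →L[ℂ] K)‖ :=
    norm_starSubalgebra_endo_le D.alg.toStarSubalgebra D.endo z
  exact h

/-- The endomorphism as a linear map. -/
def endoLin : D.alg.toStarSubalgebra →ₗ[ℂ] D.alg.toStarSubalgebra := D.endo.toAlgHom.toLinearMap

theorem coe_endoLin : (D.endoLin : D.alg.toStarSubalgebra → D.alg.toStarSubalgebra) = D.endo := rfl

theorem continuous_endo : Continuous D.endo :=
  AddMonoidHomClass.continuous_of_bound D.endo 1 fun z => by
    rw [one_mul]; exact D.norm_endo_le z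

theorem norm_endo_iterate_le (n : ℕ) (z : D.alg.toStarSubalgebra) :
    ‖D.endo^[n] z‖ ≤ ‖z‖ := norm_iterate_le (f := D.endoLin) D.norm_endo_le n z

theorem endo_iterate_star (n : ℕ) (z : D.alg.toStarSubalgebra) :
    D.endo^[n] (star z) = star (D.endo^[n] z) := by
  induction n with
  | zero => rfl
  | succ n ih => rw [Function.iterate_succ_apply', Function.iterate_succ_apply', ih, map_star]

theorem star_proj (n : ℕ) : star (D.proj n) = D.proj n := by
  rw [proj, ← endo_iterate_star, star_emb_one]

theorem proj_mul_self (n : ℕ) : D.proj n * D.proj n = D.proj n := by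
  rw [proj, ← iterate_map_mul, emb_mul, one_mul]

theorem norm_proj_le (n : ℕ) : ‖D.proj n‖ ≤ 1 :=
  (D.norm_endo_iterate_le n _).trans ((D.norm_emb_le 1).trans ContinuousLinearMap.norm_id_le)

theorem compression_endo_iterate_emb (n : ℕ) (x : G →L[ℂ] G) :
    D.compression (D.endo^[n] (D.emb x)) = τ^[n] x := D.dilates n x

theorem inner_proj_apply (n : ℕ) (a b : K) : inner ℂ ((D.proj n : K →L[ℂ] K) a) b =
    inner ℂ a ((D.proj n : K →L[ℂ] K) b) := by
  conv_rhs => rw [← D.star_proj n]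
  exact (ContinuousLinearMap.adjoint_inner_right _ _ _).symm

/-- Since `T(pₙ) = τⁿ(1) = 1`, the projection `pₙ` preserves `⟨ξ, ξ⟩` for `ξ` in `G`, and therefore
`‖pₙ ξ - ξ‖² = 0`. -/
theorem proj_apply_incl (hτ : τ 1 = 1) (n : ℕ) (g : G) :
    (D.proj n : K →L[ℂ] K) (D.incl g) = D.incl g := by
  have h1 : D.compression (D.proj n) = 1 := by
    rw [proj, compression_endo_iterate_emb, Function.iterate_fixed hτ]
  have h2 : inner ℂ (D.incl g) ((D.proj n : K →L[ℂ] K) (D.incl g)) = inner ℂ g g := by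
    rw [← inner_compress]
    exact congrArg (fun T : G →L[ℂ] G => inner ℂ g (T g)) h1
  have h4 : ∀ a, (D.proj n : K →L[ℂ] K) ((D.proj n : K →L[ℂ] K) a) = (D.proj n : K →L[ℂ] K) a :=
    fun a => congrArg (fun T : D.alg.toStarSubalgebra => (T : K →L[ℂ] K) a) (D.proj_mul_self n)
  rw [← sub_eq_zero, ← inner_self_eq_zero (𝕜 := ℂ), inner_sub_left, inner_sub_right,
    inner_sub_right, inner_proj_apply, h4, inner_proj_apply, h2, D.incl.inner_map_map]
  ring

theorem proj_mul_emb (hτ : τ 1 = 1) (n : ℕ) (x : G →L[ℂ] G) : D.proj n * D.emb x = D.emb x := by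
  refine Subtype.ext ?_
  ext k
  exact D.proj_apply_incl hτ n _

theorem proj_mul_endo_iterate_emb (hτ : τ 1 = 1) {m n : ℕ} (h : m ≤ n) (x : G →L[ℂ] G) :
    D.proj n * D.endo^[m] (D.emb x) = D.endo^[m] (D.emb x) := by
  obtain ⟨k, rfl⟩ := Nat.exists_eq_add_of_le h
  rw [proj, Function.iterate_add_apply, ← iterate_map_mul]
  exact congrArg _ (D.proj_mul_emb hτ k x)

theorem proj_mul_proj (hτ : τ 1 = 1) {m n : ℕ} (h : m ≤ n) : D.proj n * D.proj m = D.proj m :=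
  D.proj_mul_endo_iterate_emb hτ h 1

/-- Minimality enters here. A vector `θ^{n₁}(x₁) ⋯ g` is fixed by `pₙ` as soon as `n ≥ n₁`, only the
leftmost exponent mattering. Such vectors span a dense subspace, and the `pₙ` are uniformly bounded.
-/
theorem tendsto_proj (hτ : τ 1 = 1) (ξ : K) :
    Tendsto (fun n => (D.proj n : K →L[ℂ] K) ξ) atTop (𝓝 ξ) := by
  let S : Submodule ℂ K :=
    { carrier := {ξ | Tendsto (fun n => (D.proj n : K →L[ℂ] K) ξ) atTop (𝓝 ξ)}
      add_mem' := fun {a b} ha hb => by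
        simp only [Set.mem_ofPred_eq, map_add] at *
        exact ha.add hb
      zero_mem' := by simp
      smul_mem' := fun c a ha => by
        simp only [Set.mem_ofPred_eq, map_smul] at *
        exact ha.const_smul c }
  have hS : IsClosed (S : Set K) := by
    refine isClosed_of_closure_subset fun a ha => ?_
    refine Metric.tendsto_atTop.2 fun ε hε => ?_
    obtain ⟨b, hb, hab⟩ := Metric.mem_closure_iff.1 ha (ε / 3) (by positivity)
    obtain ⟨N, hN⟩ := Metric.tendsto_atTop.1 hb (ε / 3) (by positivity)
    refine ⟨N, fun n hn => ?_⟩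
    have h1 : dist ((D.proj n : K →L[ℂ] K) a) ((D.proj n : K →L[ℂ] K) b) ≤ dist a b := by
      rw [dist_eq_norm, dist_eq_norm, ← map_sub, ← one_mul ‖a - b‖]
      exact (D.proj n : K →L[ℂ] K).le_of_opNorm_le (D.norm_proj_le n) _
    have h2 := hN n hn
    have h3 := dist_triangle4 ((D.proj n : K →L[ℂ] K) a) ((D.proj n : K →L[ℂ] K) b) b a
    rw [dist_comm b a] at h3
    linarith
  have hle : (⊤ : Submodule ℂ K) ≤ S := by
    rw [← D.cyclic]
    refine Submodule.topologicalClosure_minimal _ (Submodule.span_le.2 ?_) hS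
    rintro _ ⟨L, g, rfl⟩
    cases L with
    | nil =>
      refine tendsto_const_nhds.congr fun n => ?_
      exact (D.proj_apply_incl hτ n g).symm
    | cons q L =>
      refine tendsto_const_nhds.congr' ?_
      filter_upwards [eventually_ge_atTop q.1] with n hn
      rw [List.map_cons, List.prod_cons]
      exact congrArg (fun T : D.alg.toStarSubalgebra => (T : K →L[ℂ] K) _)
        (D.proj_mul_endo_iterate_emb hτ hn q.2).symm
  exact hle trivial

theorem compression_proj_mul_mul (hτ : τ 1 = 1) (m n : ℕ) (z : D.alg.toStarSubalgebra) :
    D.compression (D.proj m * z * D.proj n) = D.compression z := by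
  ext g
  refine ext_inner_left ℂ fun g' => ?_
  change inner ℂ g' (compress D.incl _ g) = inner ℂ g' (compress D.incl _ g)
  rw [inner_compress, inner_compress]
  change inner ℂ _ ((D.proj m : K →L[ℂ] K) ((z : K →L[ℂ] K) ((D.proj n : K →L[ℂ] K) _))) = _
  rw [D.proj_apply_incl hτ]
  have : (D.proj m : K →L[ℂ] K) = ContinuousLinearMap.adjoint (D.proj m : K →L[ℂ] K) :=
    congrArg Subtype.val (D.star_proj m).symm
  rw [this, ContinuousLinearMap.adjoint_inner_right, D.proj_apply_incl hτ]

theorem endo_iterate_emb_compression (n : ℕ) (z : D.alg.toStarSubalgebra) :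
    D.endo^[n] (D.emb (D.compression z)) = D.proj n * D.endo^[n] z * D.proj n := by
  rw [emb_compression, iterate_map_mul, iterate_map_mul]
  rfl

/-- The dilation property speaks only of corner elements. It extends to all `z` because `θⁿ(pzp) =
pₙ θⁿ(z) pₙ` and `pₙ` acts as the identity on `G`, so it is invisible to `T`. -/
theorem compression_endo_iterate (hτ : τ 1 = 1) (n : ℕ) (z : D.alg.toStarSubalgebra) :
    D.compression (D.endo^[n] z) = τ^[n] (D.compression z) := by
  rw [← D.compression_endo_iterate_emb, endo_iterate_emb_compression, D.compression_proj_mul_mul hτ]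

theorem compression_endo (hτ : τ 1 = 1) (z : D.alg.toStarSubalgebra) :
    D.compression (D.endo z) = τ (D.compression z) := D.compression_endo_iterate hτ 1 z

theorem tendsto_proj_mul_mul (hτ : τ 1 = 1) (z : D.alg.toStarSubalgebra) (ξ : K) :
    Tendsto (fun n => ((D.proj n * z * D.proj n : D.alg.toStarSubalgebra) : K →L[ℂ] K) ξ) atTop
      (𝓝 ((z : K →L[ℂ] K) ξ)) := by
  have h1 : Tendsto (fun n => (z : K →L[ℂ] K) ((D.proj n : K →L[ℂ] K) ξ)) atTop
      (𝓝 ((z : K →L[ℂ] K) ξ)) := ((z : K →L[ℂ] K).continuous.tendsto ξ).comp (D.tendsto_proj hτ ξ)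
  have h2 : Tendsto (fun n => (D.proj n : K →L[ℂ] K) ((z : K →L[ℂ] K)
      ((D.proj n : K →L[ℂ] K) ξ)) - (D.proj n : K →L[ℂ] K) ((z : K →L[ℂ] K) ξ)) atTop (𝓝 0) := by
    refine squeeze_zero_norm (fun n => ?_) (tendsto_iff_norm_sub_tendsto_zero.1 h1)
    rw [← map_sub]
    refine ((D.proj n : K →L[ℂ] K).le_of_opNorm_le (D.norm_proj_le n) _).trans ?_
    rw [one_mul]
  simpa using h2.add (D.tendsto_proj hτ ((z : K →L[ℂ] K) ξ))

/-- The norm is lower semicontinuous along the strong limit `pₙ z pₙ → z`. Infinitely many `n`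
suffice, which is all that recurrence provides. -/
theorem norm_le_of_frequently (hτ : τ 1 = 1) (z : D.alg.toStarSubalgebra) {C : ℝ}
    (h : ∃ᶠ n in atTop, ‖D.proj n * z * D.proj n‖ ≤ C) : ‖z‖ ≤ C := by
  have hC : 0 ≤ C := by
    obtain ⟨n, hn⟩ := h.exists
    exact (norm_nonneg _).trans hn
  refine ContinuousLinearMap.opNorm_le_bound _ hC fun ξ => ?_
  have h1 := (D.tendsto_proj_mul_mul hτ z ξ).norm
  by_contra! h2
  obtain ⟨n, hn, hn'⟩ := (h.and_eventually (h1.eventually (lt_mem_nhds h2))).exists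
  exact absurd hn' (not_lt.2 (ContinuousLinearMap.le_of_opNorm_le _ hn ξ))

/-! ### `θ` and the compression as isometries on the peripheral space -/

theorem exists_endo_eq {z : D.alg.toStarSubalgebra} (hz : z ∈ peripheralSpace D.endo) :
    ∃ u ∈ peripheralSpace D.endo, D.endo u = z :=
  exists_map_eq_of_mem_peripheralSpace (f := D.endoLin) D.norm_endo_le hz

theorem norm_endo {z : D.alg.toStarSubalgebra} (hz : z ∈ peripheralSpace D.endo) :
    ‖D.endo z‖ = ‖z‖ :=
  norm_map_of_mem_peripheralSpace (f := D.endoLin) D.norm_endo_le hz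

theorem endo_mem {z : D.alg.toStarSubalgebra} (hz : z ∈ peripheralSpace D.endo) :
    D.endo z ∈ peripheralSpace D.endo :=
  map_mem_peripheralSpace (f := D.endoLin) D.continuous_endo hz

theorem endo_iterate_mem {z : D.alg.toStarSubalgebra} (hz : z ∈ peripheralSpace D.endo) (n : ℕ) :
    D.endo^[n] z ∈ peripheralSpace D.endo := by
  induction n with
  | zero => exact hz
  | succ n ih => rw [Function.iterate_succ_apply']; exact D.endo_mem ih

theorem norm_endo_iterate {z : D.alg.toStarSubalgebra} (hz : z ∈ peripheralSpace D.endo) (n : ℕ) :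
    ‖D.endo^[n] z‖ = ‖z‖ := by
  induction n with
  | zero => rfl
  | succ n ih => rw [Function.iterate_succ_apply', D.norm_endo (D.endo_iterate_mem hz n), ih]

theorem endo_injOn : Set.InjOn D.endo (peripheralSpace D.endo : Set D.alg.toStarSubalgebra) := by
  intro z hz w hw h
  rw [← sub_eq_zero, ← norm_eq_zero, ← D.norm_endo (Submodule.sub_mem _ hz hw), map_sub, h,
    sub_self, norm_zero]

/-- Vectors of the peripheral space have backward orbits. -/
theorem exists_backward_orbit {z : D.alg.toStarSubalgebra} (hz : z ∈ peripheralSpace D.endo) :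
    ∃ u : ℕ → D.alg.toStarSubalgebra, u 0 = z ∧ (∀ n, u n ∈ peripheralSpace D.endo) ∧
      ∀ m n, D.endo^[m] (u (m + n)) = u n := by
  choose s hs hs' using fun w : (peripheralSpace D.endo) => D.exists_endo_eq w.2
  let t : peripheralSpace D.endo → peripheralSpace D.endo := fun w => ⟨s w, hs w⟩
  refine ⟨fun n => (t^[n] ⟨z, hz⟩).1, rfl, fun n => (t^[n] ⟨z, hz⟩).2, fun m n => ?_⟩
  induction m with
  | zero => simp
  | succ m ih =>
    rw [Function.iterate_succ_apply, ← ih, add_right_comm]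
    change D.endo^[m] (D.endo (t^[m + n + 1] ⟨z, hz⟩).1) = _
    rw [Function.iterate_succ_apply']
    exact congrArg _ (hs' _)

/-- The compression is isometric on the peripheral space. -/
theorem norm_compression (hτ : τ 1 = 1) {z : D.alg.toStarSubalgebra}
    (hz : z ∈ peripheralSpace D.endo) : ‖D.compression z‖ = ‖z‖ := by
  refine le_antisymm (D.norm_compression_le z) (le_of_forall_pos_le_add fun ε hε => ?_)
  obtain ⟨u, hu0, hu, hu'⟩ := D.exists_backward_orbit hz
  refine D.norm_le_of_frequently hτ z
    ((frequently_norm_iterate_sub_lt (f := D.endoLin) D.norm_endo_le hz hε).mono fun n hn => ?_)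
  rw [coe_endoLin] at hn
  have h1 : D.endo^[n] (u n) = z := by rw [← hu0]; exact hu' n 0
  have h2 : ‖u n - z‖ < ε := by
    -- `θⁿ` is isometric on the peripheral space and sends `u n - z` to `z - θⁿ(z)`, so the backward
    -- orbit is recurrent at the same times as the forward one.
    rw [← D.norm_endo_iterate (Submodule.sub_mem _ (hu n) hz) n, iterate_map_sub, h1, norm_sub_rev]
    exact hn
  calc ‖D.proj n * z * D.proj n‖ = ‖D.endo^[n] (D.emb (D.compression (u n)))‖ := by
        rw [endo_iterate_emb_compression, h1]
    _ ≤ ‖D.compression (u n)‖ := (D.norm_endo_iterate_le _ _).trans (D.norm_emb_le _)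
    _ = ‖D.compression z + D.compression (u n - z)‖ := by
        rw [← compressionLin_apply, ← compressionLin_apply, ← compressionLin_apply, ← map_add,
          add_sub_cancel]
    _ ≤ ‖D.compression z‖ + ‖D.compression (u n - z)‖ := norm_add_le _ _
    _ ≤ ‖D.compression z‖ + ε := by
        gcongr
        exact (D.norm_compression_le _).trans h2.le

theorem compression_injOn (hτ : τ 1 = 1) :
    Set.InjOn D.compression (peripheralSpace D.endo : Set D.alg.toStarSubalgebra) := by
  intro z hz w hw h
  rw [← sub_eq_zero, ← norm_eq_zero, ← D.norm_compression hτ (Submodule.sub_mem _ hz hw),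
    ← compressionLin_apply, map_sub, compressionLin_apply, compressionLin_apply, h, sub_self,
    norm_zero]

end MinimalDilation

end DilationTheory

end

/-! ### Lifting peripheral elements, and the product as a weak limit -/

section DilationProduct

variable {G : Type u} [NormedAddCommGroup G] [InnerProductSpace ℂ G] [CompleteSpace G]
variable {K : Type v} [NormedAddCommGroup K] [InnerProductSpace ℂ K] [CompleteSpace K]

namespace MinimalDilation

variable {τ : (G →L[ℂ] G) → (G →L[ℂ] G)} (D : MinimalDilation K τ)

theorem norm_sub_proj_apply_sq (n : ℕ) (a : K) :
    ‖a - (D.proj n : K →L[ℂ] K) a‖ ^ 2 = ‖a‖ ^ 2 - ‖(D.proj n : K →L[ℂ] K) a‖ ^ 2 := by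
  have h4 : (D.proj n : K →L[ℂ] K) ((D.proj n : K →L[ℂ] K) a) = (D.proj n : K →L[ℂ] K) a :=
    congrArg (fun T : D.alg.toStarSubalgebra => (T : K →L[ℂ] K) a) (D.proj_mul_self n)
  have h5 : inner ℂ a ((D.proj n : K →L[ℂ] K) a) =
      inner ℂ ((D.proj n : K →L[ℂ] K) a) ((D.proj n : K →L[ℂ] K) a) := by
    rw [inner_proj_apply, h4]
  rw [@norm_sub_sq ℂ, h5, inner_self_eq_norm_sq]
  ring

/-- A bounded sequence of operators that is compatible with the projections converges strongly. -/
theorem cauchySeq_of_proj_mul_mul (hτ : τ 1 = 1) {z : ℕ → D.alg.toStarSubalgebra} {C : ℝ}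
    (hC : ∀ n, ‖z n‖ ≤ C) (hz : ∀ m n, m ≤ n → D.proj m * z n * D.proj m = z m) (ξ : K) :
    CauchySeq fun n => (z n : K →L[ℂ] K) ξ := by
  have hC0 : 0 ≤ C := (norm_nonneg _).trans (hC 0)
  have hp : ∀ m, CauchySeq fun n => (z n : K →L[ℂ] K) ((D.proj m : K →L[ℂ] K) ξ) := by
    intro m
    set η := (D.proj m : K →L[ℂ] K) ξ with hη
    -- On the range of `pₘ` the vectors `zₙ η` are successive projections of one another. By
    -- Pythagoras their norms increase, and differences of squared norms control distances, as for a
    -- bounded martingale.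
    have h1 : ∀ n k, m ≤ n → n ≤ k →
        (z n : K →L[ℂ] K) η = (D.proj n : K →L[ℂ] K) ((z k : K →L[ℂ] K) η) := by
      intro n k hn hk
      have : z n * D.proj m = D.proj n * (z k * D.proj m) := by
        conv_lhs => rw [← hz n k hk, mul_assoc, D.proj_mul_proj hτ hn, mul_assoc]
      exact congrArg (fun T : D.alg.toStarSubalgebra => (T : K →L[ℂ] K) ξ) this
    have h2 : ∀ n k, m ≤ n → n ≤ k → ‖(z k : K →L[ℂ] K) η - (z n : K →L[ℂ] K) η‖ ^ 2 =
        ‖(z k : K →L[ℂ] K) η‖ ^ 2 - ‖(z n : K →L[ℂ] K) η‖ ^ 2 := by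
      intro n k hn hk
      rw [h1 n k hn hk, norm_sub_proj_apply_sq]
    have hmono : Monotone fun n => ‖(z (m + n) : K →L[ℂ] K) η‖ ^ 2 := by
      intro n k hk
      have := h2 (m + n) (m + k) (by omega) (by omega)
      have := sq_nonneg ‖(z (m + k) : K →L[ℂ] K) η - (z (m + n) : K →L[ℂ] K) η‖
      simp only
      linarith
    have hbdd : BddAbove (Set.range fun n => ‖(z (m + n) : K →L[ℂ] K) η‖ ^ 2) := by
      refine ⟨(C * ‖η‖) ^ 2, ?_⟩
      rintro _ ⟨n, rfl⟩
      exact pow_le_pow_left₀ (norm_nonneg _) (ContinuousLinearMap.le_of_opNorm_le _ (hC _) η) 2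
    have hlim := (tendsto_atTop_ciSup hmono hbdd).cauchySeq
    refine Metric.cauchySeq_iff'.2 fun ε hε => ?_
    obtain ⟨N, hN⟩ := Metric.cauchySeq_iff'.1 hlim (ε ^ 2) (by positivity)
    refine ⟨m + N, fun n hn => ?_⟩
    obtain ⟨k, rfl⟩ := Nat.exists_eq_add_of_le hn
    have h3 := hN (N + k) (by omega)
    rw [Real.dist_eq, ← add_assoc] at h3
    have h4 := h2 (m + N) (m + N + k) (by omega) (by omega)
    rw [dist_eq_norm]
    refine lt_of_pow_lt_pow_left₀ 2 hε.le ?_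
    rw [h4]
    exact (le_abs_self _).trans_lt h3
  refine Metric.cauchySeq_iff'.2 fun ε hε => ?_
  -- `C + 1` replaces `C` to keep the denominator positive when `C = 0`.
  obtain ⟨m, hm⟩ := (((D.tendsto_proj hτ ξ).const_sub ξ).norm.eventually_lt_const
    (show ‖ξ - ξ‖ < ε / (3 * (C + 1)) by rw [sub_self, norm_zero]; positivity)).exists
  have hb : ∀ n, ‖(z n : K →L[ℂ] K) ξ - (z n : K →L[ℂ] K) ((D.proj m : K →L[ℂ] K) ξ)‖ < ε / 3 := by
    intro n
    rw [← map_sub]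
    refine (ContinuousLinearMap.le_of_opNorm_le _ (hC n) _).trans_lt ?_
    calc C * ‖ξ - (D.proj m : K →L[ℂ] K) ξ‖ ≤ (C + 1) * ‖ξ - (D.proj m : K →L[ℂ] K) ξ‖ := by
          gcongr; linarith
      _ < (C + 1) * (ε / (3 * (C + 1))) := by gcongr
      _ = ε / 3 := by field_simp
  obtain ⟨N, hN⟩ := Metric.cauchySeq_iff'.1 (hp m) (ε / 3) (by positivity)
  refine ⟨N, fun n hn => ?_⟩
  have h1 := hN n hn
  have h2 := hb n
  have h3 := hb N
  rw [← dist_eq_norm] at h2 h3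
  rw [dist_comm] at h3
  have h4 := dist_triangle4 ((z n : K →L[ℂ] K) ξ) ((z n : K →L[ℂ] K) ((D.proj m : K →L[ℂ] K) ξ))
    ((z N : K →L[ℂ] K) ((D.proj m : K →L[ℂ] K) ξ)) ((z N : K →L[ℂ] K) ξ)
  linarith

/-- A von Neumann algebra contains the strong limits of its bounded sequences. -/
theorem exists_strong_limit (B : VonNeumannAlgebra K) {z : ℕ → B.toStarSubalgebra} {C : ℝ}
    (hC : ∀ n, ‖z n‖ ≤ C) (hz : ∀ ξ, CauchySeq fun n => (z n : K →L[ℂ] K) ξ) :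
    ∃ w : B.toStarSubalgebra,
      ∀ ξ, Tendsto (fun n => (z n : K →L[ℂ] K) ξ) atTop (𝓝 ((w : K →L[ℂ] K) ξ)) := by
  choose f hf using fun ξ => cauchySeq_tendsto_of_complete (hz ξ)
  let w : K →L[ℂ] K := ContinuousLinearMap.ofTendstoOfBoundedRange f
    (fun n => (z n : K →L[ℂ] K)) (tendsto_pi_nhds.2 hf)
    (isBounded_iff_forall_norm_le.2 ⟨C, by rintro _ ⟨n, rfl⟩; exact hC n⟩)
  refine ⟨⟨w, ?_⟩, hf⟩
  change w ∈ (B : Set (K →L[ℂ] K))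
  rw [← B.centralizer_centralizer, Set.mem_centralizer_iff]
  intro y hy
  rw [Set.mem_centralizer_iff] at hy
  ext ξ
  have h1 : Tendsto (fun n => y ((z n : K →L[ℂ] K) ξ)) atTop (𝓝 (y (w ξ))) :=
    (y.continuous.tendsto _).comp (hf ξ)
  refine tendsto_nhds_unique h1 ((hf (y ξ)).congr fun n => ?_)
  exact congrArg (fun T : K →L[ℂ] K => T ξ) (hy _ (z n).2)

/-- The lift is the strong limit of `zₙ = c⁻ⁿ θⁿ(x)`. These are bounded, satisfy `pₘ zₙ pₘ = zₘ` for
`m ≤ n`, and obey `θ(zₙ) = c zₙ₊₁`, an identity that survives the limit because `θ` is normal. -/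
theorem exists_eigen_lift (hτ : τ 1 = 1) {c : ℂ} (hc : ‖c‖ = 1) {x : G →L[ℂ] G}
    (hx : τ x = c • x) : ∃ z, D.endo z = c • z ∧ D.compression z = x := by
  have hc0 : c ≠ 0 := by rintro rfl; simp at hc
  have hsmul : ∀ (n : ℕ) (a : ℂ) (w : D.alg.toStarSubalgebra),
      D.endo^[n] (a • w) = a • D.endo^[n] w := by
    intro n a w
    induction n with
    | zero => rfl
    | succ n ih => rw [Function.iterate_succ_apply', Function.iterate_succ_apply', ih, map_smul]
  -- `τ` is a bare function here, so homogeneity of its iterates is borrowed from `θ` through the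
  -- compression.
  have hxn : ∀ n : ℕ, τ^[n] x = c ^ n • x := by
    intro n
    rw [← D.compression_endo_iterate_emb]
    induction n with
    | zero => rw [Function.iterate_zero, id, compression_emb, pow_zero, one_smul]
    | succ n ih =>
      rw [D.compression_endo_iterate hτ, compression_emb] at ih ⊢
      rw [Function.iterate_succ_apply, hx]
      have h := D.compression_endo_iterate hτ n (c • D.emb x)
      rw [← emb_smul, compression_emb, emb_smul, hsmul, ← compressionLin_apply, map_smul,
        compressionLin_apply, D.compression_endo_iterate hτ, compression_emb, ih] at h
      rw [← h, smul_smul, pow_succ']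
  let z : ℕ → D.alg.toStarSubalgebra := fun n => (c ^ n)⁻¹ • D.endo^[n] (D.emb x)
  have hz : ∀ m n, m ≤ n → D.proj m * z n * D.proj m = z m := by
    intro m n h
    obtain ⟨k, rfl⟩ := Nat.exists_eq_add_of_le h
    simp only [z]
    rw [mul_smul_comm, smul_mul_assoc, Function.iterate_add_apply,
      ← endo_iterate_emb_compression, D.compression_endo_iterate_emb, hxn, emb_smul, hsmul,
      smul_smul, pow_add, mul_inv, mul_assoc, inv_mul_cancel₀ (pow_ne_zero _ hc0), mul_one]
  have hC : ∀ n, ‖z n‖ ≤ ‖x‖ := by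
    intro n
    have h1 : ‖z n‖ = ‖D.endo^[n] (D.emb x)‖ := by
      simp only [z]
      rw [norm_smul, norm_inv, norm_pow, hc, one_pow, inv_one, one_mul]
    rw [h1]
    exact (D.norm_endo_iterate_le _ _).trans (D.norm_emb_le x)
  obtain ⟨w, hw⟩ := exists_strong_limit D.alg hC (D.cauchySeq_of_proj_mul_mul hτ hC hz)
  refine ⟨w, ?_, ?_⟩
  · have h1 := D.normal ‖x‖ (map z atTop) w (eventually_map.2 (Eventually.of_forall hC))
      fun ξ η => tendsto_map'_iff.2 (tendsto_const_nhds.inner (hw η))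
    refine Subtype.ext ?_
    ext η
    refine ext_inner_left ℂ fun ξ => ?_
    refine tendsto_nhds_unique (tendsto_map'_iff.1 (h1 ξ η)) ?_
    have h2 : Tendsto (fun n => inner ℂ ξ (c • (z (n + 1) : K →L[ℂ] K) η)) atTop
        (𝓝 (inner ℂ ξ (c • (w : K →L[ℂ] K) η))) :=
      tendsto_const_nhds.inner (((tendsto_add_atTop_iff_nat 1).2 (hw η)).const_smul c)
    refine h2.congr fun n => ?_
    have h3 : c • z (n + 1) = D.endo (z n) := by
      simp only [z]
      rw [map_smul, ← Function.iterate_succ_apply' D.endo, smul_smul, pow_succ', mul_inv,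
        mul_inv_cancel_left₀ hc0]
    exact congrArg (fun T : D.alg.toStarSubalgebra => inner ℂ ξ ((T : K →L[ℂ] K) η)) h3
  · ext g
    refine ext_inner_left ℂ fun g' => ?_
    have h1 : Tendsto (fun n => inner ℂ (D.incl g') ((z n : K →L[ℂ] K) (D.incl g))) atTop
        (𝓝 (inner ℂ (D.incl g') ((w : K →L[ℂ] K) (D.incl g)))) :=
      tendsto_const_nhds.inner (hw _)
    rw [← inner_compress] at h1
    refine tendsto_nhds_unique h1 (tendsto_const_nhds.congr fun n => ?_)
    rw [← inner_compress]
    have h2 : D.compression (z n) = x := by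
      simp only [z]
      rw [← compressionLin_apply, map_smul, compressionLin_apply, D.compression_endo_iterate_emb,
        hxn, smul_smul, inv_mul_cancel₀ (pow_ne_zero _ hc0), one_smul]
    exact congrArg (fun T : G →L[ℂ] G => inner ℂ g' (T g)) h2.symm

theorem compression_mem (hτ : τ 1 = 1) {z : D.alg.toStarSubalgebra}
    (hz : z ∈ peripheralSpace D.endo) : D.compression z ∈ peripheralSpace τ := by
  refine peripheralSpace_le (M := (peripheralSpace τ).comap D.compressionLin)
    ((isClosed_peripheralSpace τ).preimage D.continuous_compression) (fun c y hc hy => ?_) hz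
  refine mem_peripheralSpace_of_eigen hc ?_
  rw [compressionLin_apply, ← D.compression_endo hτ, hy, ← compressionLin_apply, map_smul]
  rfl

/-- `T` is isometric on `P(θ)`, so its image is closed; it contains all peripheral eigenvectors of
`τ`. This makes `lift` a genuine inverse of `T`. -/
theorem exists_compression_eq (hτ : τ 1 = 1) {x : G →L[ℂ] G} (hx : x ∈ peripheralSpace τ) :
    ∃ z ∈ peripheralSpace D.endo, D.compression z = x := by
  have : CompleteSpace D.alg.toStarSubalgebra :=
    (isClosed_vonNeumannAlgebra D.alg).completeSpace_coe
  have h : peripheralSpace τ ≤ (peripheralSpace D.endo).map D.compressionLin := by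
    refine peripheralSpace_le (isClosed_map_of_isometric D.compressionLin
      (isClosed_peripheralSpace D.endo) fun z hz => D.norm_compression hτ hz) fun c y hc hy => ?_
    obtain ⟨z, hz, hzy⟩ := D.exists_eigen_lift hτ hc hy
    exact ⟨z, mem_peripheralSpace_of_eigen hc hz, hzy⟩
  exact h hx

theorem lift_mem (hτ : τ 1 = 1) {x : G →L[ℂ] G} (hx : x ∈ peripheralSpace τ) :
    D.lift x ∈ peripheralSpace D.endo :=
  Function.invFunOn_mem (D.exists_compression_eq hτ hx)

theorem compression_lift (hτ : τ 1 = 1) {x : G →L[ℂ] G} (hx : x ∈ peripheralSpace τ) :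
    D.compression (D.lift x) = x :=
  Function.invFunOn_eq (D.exists_compression_eq hτ hx)

theorem lift_compression (hτ : τ 1 = 1) {z : D.alg.toStarSubalgebra}
    (hz : z ∈ peripheralSpace D.endo) : D.lift (D.compression z) = z :=
  D.compression_injOn hτ (D.lift_mem hτ (D.compression_mem hτ hz)) hz
    (D.compression_lift hτ (D.compression_mem hτ hz))

theorem mul_mem_peripheralSpace {z w : D.alg.toStarSubalgebra} (hz : z ∈ peripheralSpace D.endo)
    (hw : w ∈ peripheralSpace D.endo) : z * w ∈ peripheralSpace D.endo := by
  refine peripheralSpace_le (M := (peripheralSpace D.endo).comap (LinearMap.mulLeft ℂ z))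
    ((isClosed_peripheralSpace _).preimage (continuous_const_mul z)) (fun c y hc hy => ?_) hw
  refine peripheralSpace_le (M := (peripheralSpace D.endo).comap (LinearMap.mulRight ℂ y))
    ((isClosed_peripheralSpace _).preimage (continuous_mul_const y)) (fun a b ha hb => ?_) hz
  refine mem_peripheralSpace_of_eigen (c := a * c) (by rw [norm_mul, ha, hc, one_mul]) ?_
  rw [LinearMap.mulRight_apply, map_mul, hb, hy, smul_mul_smul_comm]

theorem star_mem_peripheralSpace {z : D.alg.toStarSubalgebra} (hz : z ∈ peripheralSpace D.endo) :
    star z ∈ peripheralSpace D.endo := by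
  let M : Submodule ℂ D.alg.toStarSubalgebra :=
    { carrier := {z | star z ∈ peripheralSpace D.endo}
      add_mem' := fun {a b} ha hb => by
        simp only [Set.mem_ofPred_eq, star_add] at *
        exact Submodule.add_mem _ ha hb
      zero_mem' := by simp
      smul_mem' := fun c a ha => by
        simp only [Set.mem_ofPred_eq, star_smul] at *
        exact Submodule.smul_mem _ _ ha }
  have hcont : Continuous fun z : D.alg.toStarSubalgebra => star z :=
    Continuous.subtype_mk (continuous_star.comp continuous_subtype_val) _
  refine peripheralSpace_le (M := M)
    ((isClosed_peripheralSpace _).preimage hcont) (fun c y hc hy => ?_) hz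
  refine mem_peripheralSpace_of_eigen (c := star c) (by rw [norm_star, hc]) ?_
  rw [map_star, hy, star_smul]

/-- `T(uₙ)T(vₙ) = T(uₙ p vₙ)`, and applying `τⁿ` turns this into `T(z pₙ w)`; then `pₙ → 1`
strongly. Products in the dilation are thereby computed from `τ` alone. -/
theorem tendsto_inner_compression_mul (hτ : τ 1 = 1) {z w : D.alg.toStarSubalgebra}
    {u v : ℕ → D.alg.toStarSubalgebra} (hu : ∀ n, D.endo^[n] (u n) = z)
    (hv : ∀ n, D.endo^[n] (v n) = w) (g g' : G) :
    Tendsto (fun n => inner ℂ g (τ^[n] (D.compression (u n) * D.compression (v n)) g')) atTop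
      (𝓝 (inner ℂ g (D.compression (z * w) g'))) := by
  have h1 : Tendsto (fun n => inner ℂ (D.incl g) ((z : K →L[ℂ] K) ((D.proj n : K →L[ℂ] K)
      ((w : K →L[ℂ] K) (D.incl g'))))) atTop
      (𝓝 (inner ℂ (D.incl g) ((z : K →L[ℂ] K) ((w : K →L[ℂ] K) (D.incl g'))))) :=
    tendsto_const_nhds.inner (((z : K →L[ℂ] K).continuous.tendsto _).comp (D.tendsto_proj hτ _))
  have h2 : inner ℂ g (D.compression (z * w) g') =
      inner ℂ (D.incl g) ((z : K →L[ℂ] K) ((w : K →L[ℂ] K) (D.incl g'))) := inner_compress _ _ _ _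
  rw [h2]
  refine h1.congr fun n => ?_
  have h3 : D.compression (u n) * D.compression (v n) =
      D.compression (u n * D.emb 1 * v n) := rfl
  rw [h3, ← D.compression_endo_iterate hτ, iterate_map_mul, iterate_map_mul, hu, hv]
  exact (inner_compress D.incl ((z * D.proj n * w : D.alg.toStarSubalgebra) : K →L[ℂ] K) g g').symm

end MinimalDilation

end DilationProduct

/-! ### The word basis and the right creation operators -/

section WordBasis

variable {H : Type u} [NormedAddCommGroup H] [InnerProductSpace ℂ H]

theorem inner_leftCreation (ξ ξ' : H) (η η' : FockSpace H) :
    inner ℂ (leftCreation ξ η) (leftCreation ξ' η') = inner ℂ ξ ξ' * inner ℂ η η' := by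
  have h1 := lp.hasSum_inner (𝕜 := ℂ) (leftCreation ξ η) (leftCreation ξ' η')
  have h2 := (lp.hasSum_inner (𝕜 := ℂ) η η').mul_left (inner ℂ ξ ξ')
  rw [← hasSum_nat_add_iff' 1] at h1
  have h3 := h1.unique (h2.congr_fun fun n => by
    rw [leftCreation_apply_succ, leftCreation_apply_succ, inner_tensorCons])
  rwa [Finset.sum_range_one, leftCreation_apply_zero, inner_zero_left, sub_zero] at h3

theorem inner_vacuum_vacuum : inner ℂ (vacuum H) (vacuum H) = (1 : ℂ) := by
  rw [vacuum, pureVector, lp.inner_single_left]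
  rw [lp.single_apply_self]
  change inner ℂ (EuclideanSpace.single PUnit.unit (1 : ℂ))
    (EuclideanSpace.single PUnit.unit (1 : ℂ)) = (1 : ℂ)
  simp

theorem inner_vacuum_leftCreation (ξ : H) (η : FockSpace H) :
    inner ℂ (vacuum H) (leftCreation ξ η) = 0 := by
  rw [vacuum, pureVector, lp.inner_single_left]
  change inner ℂ _ (leftCreation ξ η 0) = _
  rw [leftCreation_apply_zero, inner_zero_right]

theorem tensorCons_add (ξ ξ' : H) (n : ℕ) (η : TensorPower H n) :
    tensorCons (ξ + ξ') n η = tensorCons ξ n η + tensorCons ξ' n η :=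
  (congrArg (UniformSpace.Completion.toComplL (𝕜 := ℂ) (E := H ⊗[ℂ] TensorPower H n))
    (TensorProduct.add_tmul ξ ξ' η)).trans (map_add _ _ _)

theorem tensorCons_smul (c : ℂ) (ξ : H) (n : ℕ) (η : TensorPower H n) :
    tensorCons (c • ξ) n η = c • tensorCons ξ n η :=
  (congrArg (UniformSpace.Completion.toComplL (𝕜 := ℂ) (E := H ⊗[ℂ] TensorPower H n))
    (TensorProduct.smul_tmul' c ξ η).symm).trans (map_smul _ _ _)

theorem leftCreation_add (ξ ξ' : H) (η : FockSpace H) :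
    leftCreation (ξ + ξ') η = leftCreation ξ η + leftCreation ξ' η := by
  ext n
  rcases n with _ | n
  · exact (add_zero _).symm
  · exact tensorCons_add ξ ξ' n (η n)

theorem leftCreation_smul (c : ℂ) (ξ : H) (η : FockSpace H) :
    leftCreation (c • ξ) η = c • leftCreation ξ η := by
  ext n
  rcases n with _ | n
  · exact (smul_zero (A := TensorPower H 0) c).symm
  · exact tensorCons_smul c ξ n (η n)

theorem leftCreation_single (ξ : H) (n : ℕ) (η : TensorPower H n) :
    leftCreation ξ (lp.single 2 n η) = lp.single 2 (n + 1) (tensorCons ξ n η) := by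
  ext m
  rcases m with _ | m
  · rw [leftCreation_apply_zero, lp.single_apply_ne]
    simp
  · rw [leftCreation_apply_succ]
    by_cases hm : m = n
    · subst hm
      exact (congrArg _ (lp.single_apply_self _ _ _)).trans
        (lp.single_apply_self 2 (m + 1) (tensorCons ξ m η)).symm
    · rw [lp.single_apply_ne 2 _ _ hm, lp.single_apply_ne, map_zero]
      simpa using hm

/-- A closed subspace of the full Fock space that contains `Ω` and is invariant under the creation
operators of an orthonormal basis is the whole space. -/
theorem eq_top_of_leftCreation_mem {Θ : Type v} (e : HilbertBasis Θ ℂ H)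
    {M : Submodule ℂ (FockSpace H)} (hM : IsClosed (M : Set (FockSpace H))) (h0 : vacuum H ∈ M)
    (hl : ∀ i, ∀ η ∈ M, leftCreation (e i) η ∈ M) : M = ⊤ := by
  -- For fixed `η` the map `ξ ↦ ξ ⊗ η` is linear and continuous, so invariance passes from the basis
  -- to all of `H`.
  have hl' : ∀ (ξ : H), ∀ η ∈ M, leftCreation ξ η ∈ M := by
    intro ξ η hη
    let f : H →ₗ[ℂ] FockSpace H :=
      { toFun := fun ξ => leftCreation ξ η
        map_add' := fun ξ ξ' => leftCreation_add ξ ξ' η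
        map_smul' := fun c ξ => leftCreation_smul c ξ η }
    have hf : Continuous f := AddMonoidHomClass.continuous_of_bound f ‖η‖ fun ξ => by
      rw [mul_comm]; exact (norm_leftCreation_apply ξ η).le
    have h : (⊤ : Submodule ℂ H) ≤ M.comap f := by
      rw [← e.dense_span]
      refine Submodule.topologicalClosure_minimal _ (Submodule.span_le.2 ?_) (hM.preimage hf)
      rintro _ ⟨i, rfl⟩
      exact hl i η hη
    exact h trivial
  have hs : ∀ n (x : TensorPower H n), lp.single 2 n x ∈ M := by
    intro n
    induction n with
    | zero =>
      intro x
      obtain ⟨c, rfl⟩ : ∃ c : ℂ, x = c • (pureTensor [] : TensorPower H 0) := by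
        let y : EuclideanSpace ℂ PUnit := x
        refine ⟨y PUnit.unit, ?_⟩
        change y = y PUnit.unit • EuclideanSpace.single PUnit.unit (1 : ℂ)
        refine PiLp.ext fun i => ?_
        cases i
        simp
      rw [lp.single_smul]
      exact M.smul_mem c h0
    | succ n ih =>
      let T := lp.singleContinuousLinearMap ℂ (fun n => TensorPower H n) 2 (n + 1)
      have hcl : IsClosed {x : TensorPower H (n + 1) | T x ∈ M} := hM.preimage T.continuous
      intro x
      refine UniformSpace.Completion.induction_on
        (p := fun x : TensorPower H (n + 1) => T x ∈ M) x hcl fun a => ?_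
      let T' : H ⊗[ℂ] TensorPower H n →L[ℂ] FockSpace H := T ∘L
        (UniformSpace.Completion.toComplL (𝕜 := ℂ) (E := H ⊗[ℂ] TensorPower H n))
      change T' a ∈ M
      induction a using TensorProduct.induction_on with
      | zero => rw [map_zero]; exact M.zero_mem
      | tmul ξ η =>
        have h := hl' ξ _ (ih η)
        rw [leftCreation_single] at h
        exact h
      | add a b ha hb => rw [map_add]; exact M.add_mem ha hb
  rw [eq_top_iff]
  intro η _
  exact hM.mem_of_tendsto (lp.hasSum_single (by norm_num) η)
    (Eventually.of_forall fun S => M.sum_mem fun n _ => hs n _)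

variable {Θ : Type v}

theorem wordVector_nil (e : HilbertBasis Θ ℂ H) : wordVector e [] = vacuum H := rfl

theorem wordVector_cons (e : HilbertBasis Θ ℂ H) (i : Θ) (I : List Θ) :
    wordVector e (i :: I) = leftCreation (e i) (wordVector e I) :=
  (leftCreation_pureVector _ _).symm

theorem inner_wordVector [DecidableEq Θ] (e : HilbertBasis Θ ℂ H) (I J : List Θ) :
    inner ℂ (wordVector e I) (wordVector e J) = if I = J then 1 else (0 : ℂ) := by
  induction I generalizing J with
  | nil =>
    cases J with
    | nil => rw [wordVector_nil, inner_vacuum_vacuum, if_pos rfl]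
    | cons j J => rw [wordVector_nil, wordVector_cons, inner_vacuum_leftCreation, if_neg (by simp)]
  | cons i I ih =>
    cases J with
    | nil =>
      rw [wordVector_nil, wordVector_cons, ← inner_conj_symm, inner_vacuum_leftCreation, map_zero,
        if_neg (by simp)]
    | cons j J =>
      rw [wordVector_cons, wordVector_cons, inner_leftCreation, ih,
        orthonormal_iff_ite.1 e.orthonormal]
      by_cases h1 : i = j <;> by_cases h2 : I = J <;> simp [h1, h2]

/-- The word vectors form an orthonormal basis of the full Fock space. -/
theorem exists_wordBasis [DecidableEq Θ] (e : HilbertBasis Θ ℂ H) :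
    ∃ b : HilbertBasis (List Θ) ℂ (FockSpace H), ∀ I, b I = wordVector e I := by
  have ho : Orthonormal ℂ (wordVector e) := orthonormal_iff_ite.2 (inner_wordVector e)
  have ht : (Submodule.span ℂ (Set.range (wordVector e))).topologicalClosure = ⊤ := by
    refine eq_top_of_leftCreation_mem e (Submodule.isClosed_topologicalClosure _)
      (Submodule.le_topologicalClosure _ (Submodule.subset_span ⟨[], rfl⟩)) fun i => ?_
    have h : (Submodule.span ℂ (Set.range (wordVector e))).topologicalClosure ≤
        (Submodule.span ℂ (Set.range (wordVector e))).topologicalClosure.comap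
          (leftCreation (e i)).toLinearMap := by
      refine Submodule.topologicalClosure_minimal _ (Submodule.span_le.2 ?_)
        ((Submodule.isClosed_topologicalClosure _).preimage (leftCreation (e i)).continuous)
      rintro _ ⟨I, rfl⟩
      exact Submodule.le_topologicalClosure _ (Submodule.subset_span
        ⟨i :: I, wordVector_cons e i I⟩)
    exact fun η hη => h hη
  exact ⟨HilbertBasis.mk ho ht.ge, fun I => congrFun (HilbertBasis.coe_mk ho ht.ge) I⟩

theorem dense_span_wordVector [DecidableEq Θ] (e : HilbertBasis Θ ℂ H) :
    Dense (Submodule.span ℂ (Set.range (wordVector e)) : Set (FockSpace H)) := by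
  obtain ⟨b, hb⟩ := exists_wordBasis e
  rw [← (funext hb : (b : List Θ → FockSpace H) = _)]
  exact Submodule.dense_iff_topologicalClosure_eq_top.2 b.dense_span

/-- An injective map of the index set of an orthonormal basis is implemented by an isometry. -/
theorem exists_linearIsometry_apply_basis {ι E : Type*} [NormedAddCommGroup E]
    [InnerProductSpace ℂ E] [CompleteSpace E] (b : HilbertBasis ι ℂ E) {f : ι → ι}
    (hf : Function.Injective f) : ∃ V : E →ₗᵢ[ℂ] E, ∀ i, V (b i) = b (f i) := by
  classical
  have ho : Orthonormal ℂ (fun i => b (f i)) := b.orthonormal.comp _ hf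
  have hfam : OrthogonalFamily ℂ (fun _ : ι => ℂ)
      fun i => LinearIsometry.toSpanSingleton ℂ _ (ho.1 i) := ho.orthogonalFamily
  refine ⟨hfam.linearIsometry.comp b.repr.toLinearIsometry, fun i => ?_⟩
  change hfam.linearIsometry (b.repr (b i)) = _
  rw [HilbertBasis.repr_self, OrthogonalFamily.linearIsometry_apply_single]
  simp

variable [DecidableEq Θ]

/-- `R` is the right creation operator `η ↦ η ⊗ eⱼ`. -/
def IsRightCreation (e : HilbertBasis Θ ℂ H) (j : Θ) (R : FockSpace H →L[ℂ] FockSpace H) : Prop :=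
  ∀ I, R (wordVector e I) = wordVector e (I ++ [j])

theorem exists_isRightCreation (e : HilbertBasis Θ ℂ H) (j : Θ) :
    ∃ R, IsRightCreation e j R := by
  obtain ⟨b, hb⟩ := exists_wordBasis e
  obtain ⟨V, hV⟩ := exists_linearIsometry_apply_basis b (List.append_left_injective [j])
  refine ⟨V.toContinuousLinearMap, fun I => ?_⟩
  have h := hV I
  rwa [hb, hb] at h

theorem IsRightCreation.apply_leftCreation {e : HilbertBasis Θ ℂ H} {j : Θ}
    {R : FockSpace H →L[ℂ] FockSpace H} (hR : IsRightCreation e j R) (i : Θ) (η : FockSpace H) :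
    R (leftCreation (e i) η) = leftCreation (e i) (R η) := by
  have h : R ∘L leftCreation (e i) = leftCreation (e i) ∘L R := by
    refine ContinuousLinearMap.ext_on (dense_span_wordVector e) ?_
    rintro _ ⟨I, rfl⟩
    rw [ContinuousLinearMap.comp_apply, ContinuousLinearMap.comp_apply, ← wordVector_cons, hR, hR,
      ← wordVector_cons, List.cons_append]
  exact congrArg (fun T : FockSpace H →L[ℂ] FockSpace H => T η) h

/-- This is the adjoint relation `R* e_{Jk} = δ_{kj} e_J` in weak form. -/
theorem IsRightCreation.inner_apply {e : HilbertBasis Θ ℂ H} {j : Θ}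
    {R : FockSpace H →L[ℂ] FockSpace H} (hR : IsRightCreation e j R) (J : List Θ) (k : Θ)
    (η : FockSpace H) : inner ℂ (wordVector e (J ++ [k])) (R η) =
      (if k = j then 1 else 0) * inner ℂ (wordVector e J) η := by
  have h : innerSL ℂ (wordVector e (J ++ [k])) ∘L R =
      (if k = j then 1 else (0 : ℂ)) • innerSL ℂ (wordVector e J) := by
    refine ContinuousLinearMap.ext_on (dense_span_wordVector e) ?_
    rintro _ ⟨I, rfl⟩
    rw [ContinuousLinearMap.comp_apply, smul_apply, innerSL_apply_apply,
      innerSL_apply_apply, hR, inner_wordVector, inner_wordVector, smul_eq_mul]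
    by_cases h1 : k = j <;> by_cases h2 : J = I <;> simp [h1, h2]
  exact congrArg (fun T : FockSpace H →L[ℂ] ℂ => T η) h

end WordBasis

/-! ### How `P_ω` interacts with right creation operators -/

section FockMap

variable {H : Type u} [NormedAddCommGroup H] [InnerProductSpace ℂ H]
variable {Θ : Type v} (e : HilbertBasis Θ ℂ H) {ω : Θ → ℝ}

theorem hasSum_inner_fockMap (hω : Summable ω) (x : FockSpace H →L[ℂ] FockSpace H)
    (g g' : FockSpace H) :
    HasSum (fun i => (ω i : ℂ) * inner ℂ (leftCreation (e i) g) (x (leftCreation (e i) g')))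
      (inner ℂ g (fockMap e ω x g')) := by
  have h := (summable_fockMap e hω x).hasSum
  have h2 := (h.mapL (ContinuousLinearMap.apply ℂ (FockSpace H) g')).mapL (innerSL ℂ g)
  refine h2.congr_fun fun i => ?_
  change _ = inner ℂ g ((ω i : ℂ) • ContinuousLinearMap.adjoint (leftCreation (e i))
    (x (leftCreation (e i) g')))
  rw [inner_smul_right, ContinuousLinearMap.adjoint_inner_right]

theorem fockMap_one (hsum : HasSum ω 1) : fockMap e ω 1 = 1 := by
  ext1 g'
  refine ext_inner_left ℂ fun g => ?_
  refine (hasSum_inner_fockMap e hsum.summable 1 g g').unique ?_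
  have h := (Complex.hasSum_ofReal.2 hsum).mul_right (inner ℂ g g')
  rw [Complex.ofReal_one, one_mul] at h
  refine h.congr_fun fun i => ?_
  change _ * inner ℂ (leftCreation (e i) g) (leftCreation (e i) g') = _
  rw [inner_leftCreation, inner_self_eq_norm_sq_to_K, e.orthonormal.1 i]
  simp

variable [DecidableEq Θ] {e} {j : Θ} {R : FockSpace H →L[ℂ] FockSpace H}

/-- `R` commutes with each `l_i` and so can be pulled out on the right. It cannot be pulled out on
the left, since `l_i* R` and `R l_i*` differ on the vacuum when `i = j`. -/
theorem fockMap_mul_rightCreation (hω : Summable ω) (hR : IsRightCreation e j R)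
    (x : FockSpace H →L[ℂ] FockSpace H) : fockMap e ω (x * R) = fockMap e ω x * R := by
  ext1 g'
  refine ext_inner_left ℂ fun g => ?_
  refine (hasSum_inner_fockMap e hω (x * R) g g').unique ?_
  refine (hasSum_inner_fockMap e hω x g (R g')).congr_fun fun i => ?_
  rw [← hR.apply_leftCreation]
  rfl

theorem fockMap_iterate_mul_rightCreation (hω : Summable ω) (hR : IsRightCreation e j R) (n : ℕ)
    (x : FockSpace H →L[ℂ] FockSpace H) :
    (fockMap e ω)^[n] (x * R) = (fockMap e ω)^[n] x * R := by
  induction n with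
  | zero => rfl
  | succ n ih =>
    rw [Function.iterate_succ_apply', Function.iterate_succ_apply', ih,
      fockMap_mul_rightCreation hω hR]

theorem fockMap_rightCreation (hsum : HasSum ω 1) (hR : IsRightCreation e j R) :
    fockMap e ω R = R := by
  have h := fockMap_mul_rightCreation hsum.summable hR 1
  rwa [fockMap_one e hsum, one_mul] at h

/-- Each application of `P_ω` prepends a letter to the row word and leaves its last letter `k` in
place, where `R*` removes it at the end. -/
theorem inner_concat_fockMap_iterate_rightCreation_mul (hω : Summable ω)
    (hR : IsRightCreation e j R) (x : FockSpace H →L[ℂ] FockSpace H) (n : ℕ) (J : List Θ) (k : Θ)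
    (g : FockSpace H) :
    inner ℂ (wordVector e (J ++ [k])) ((fockMap e ω)^[n] (R * x) g) =
      (if k = j then 1 else 0) * inner ℂ (wordVector e J) ((fockMap e ω)^[n] x g) := by
  induction n generalizing J g with
  | zero => exact hR.inner_apply J k (x g)
  | succ n ih =>
    rw [Function.iterate_succ_apply', Function.iterate_succ_apply']
    refine (hasSum_inner_fockMap e hω _ _ _).unique ?_
    refine ((hasSum_inner_fockMap e hω _ _ _).mul_left _).congr_fun fun i => ?_
    rw [← wordVector_cons, ← wordVector_cons, ← List.cons_append, ih]
    ring

/-- The row `Ω` has no letter to strip until one application of `P_ω` turns it into `e_i`. Only `i =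
j` survives, which costs the weight `ω_j`, one power of `P_ω`, and a letter `j` prepended on the
column side. -/
theorem inner_vacuum_fockMap_iterate_rightCreation_mul (hω : Summable ω)
    (hR : IsRightCreation e j R) (x : FockSpace H →L[ℂ] FockSpace H) (n : ℕ) (g : FockSpace H) :
    inner ℂ (vacuum H) ((fockMap e ω)^[n + 1] (R * x) g) =
      ω j * inner ℂ (vacuum H) ((fockMap e ω)^[n] x (leftCreation (e j) g)) := by
  rw [Function.iterate_succ_apply']
  refine (hasSum_inner_fockMap e hω _ _ _).unique ?_
  have h : ∀ i, inner ℂ (leftCreation (e i) (vacuum H)) ((fockMap e ω)^[n] (R * x)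
      (leftCreation (e i) g)) = (if i = j then 1 else 0) * inner ℂ (vacuum H)
        ((fockMap e ω)^[n] x (leftCreation (e i) g)) := by
    intro i
    rw [← wordVector_nil e, ← wordVector_cons]
    exact inner_concat_fockMap_iterate_rightCreation_mul hω hR x n [] i _
  simp only [h]
  convert hasSum_ite_eq j ((ω j : ℂ) * inner ℂ (vacuum H)
    ((fockMap e ω)^[n] x (leftCreation (e j) g))) using 2 with i
  by_cases hi : i = j
  · subst hi; simp
  · simp [hi]

end FockMap

/-! ### The relative commutant -/

section RelativeCommutant

variable {H : Type u} [NormedAddCommGroup H] [InnerProductSpace ℂ H]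
variable {Θ : Type v} {e : HilbertBasis Θ ℂ H} {ω : Θ → ℝ}
variable {K : Type w} [NormedAddCommGroup K] [InnerProductSpace ℂ K] [CompleteSpace K]

namespace MinimalDilation

variable {D : MinimalDilation K (fockMap e ω)}

theorem smul_one_mem_relativeCommutant (hsum : HasSum ω 1) (c : ℂ) :
    c • (1 : FockSpace H →L[ℂ] FockSpace H) ∈ D.relativeCommutant := by
  have h1 := fockMap_one e hsum
  have hone : (1 : D.alg.toStarSubalgebra) ∈ peripheralSpace D.endo :=
    mem_peripheralSpace_of_eigen (c := 1) norm_one (by rw [map_one, one_smul])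
  have hc := Submodule.smul_mem _ c hone
  have hT : D.compression (c • 1) = c • 1 := by
    rw [← compressionLin_apply, map_smul, compressionLin_apply, compression_one]
  have hl := D.lift_compression h1 hc
  rw [hT] at hl
  refine ⟨hT ▸ D.compression_mem h1 hc, fun y _ => ?_⟩
  rw [circ, circ, hl, smul_mul_assoc, mul_smul_comm, one_mul, mul_one]

/-- Both products lie in `P(θ)`, where `T` is injective, so commutation for `∘` is commutation in
the dilation. -/
theorem lift_mul_comm_of_mem_relativeCommutant (hsum : HasSum ω 1)
    {x : FockSpace H →L[ℂ] FockSpace H} (hx : x ∈ D.relativeCommutant)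
    {w : D.alg.toStarSubalgebra} (hw : D.endo w = w) : D.lift x * w = w * D.lift x := by
  have h1 := fockMap_one e hsum
  have hwm : w ∈ peripheralSpace D.endo :=
    mem_peripheralSpace_of_eigen (c := 1) norm_one (by rw [hw, one_smul])
  have h := hx.2 (D.compression w) (by
    change fockMap e ω _ = _
    rw [← D.compression_endo h1, hw])
  rw [circ, circ, D.lift_compression h1 hwm] at h
  exact D.compression_injOn h1 (D.mul_mem_peripheralSpace (D.lift_mem h1 hx.1) hwm)
    (D.mul_mem_peripheralSpace hwm (D.lift_mem h1 hx.1)) h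

variable [DecidableEq Θ] (D)

theorem exists_rightCreation_lift (hsum : HasSum ω 1) (j : Θ) :
    ∃ W, D.endo W = W ∧ IsRightCreation e j (D.compression W) := by
  obtain ⟨R, hR⟩ := exists_isRightCreation e j
  obtain ⟨W, hW, hWR⟩ := D.exists_eigen_lift (fockMap_one e hsum) (c := 1) norm_one (x := R)
    (by rw [fockMap_rightCreation hsum hR, one_smul])
  exact ⟨W, by rw [hW, one_smul], hWR ▸ hR⟩

variable {D} {j : Θ} {z W : D.alg.toStarSubalgebra}

/-- The sequence whose limit is the product is constant: `Pⁿ(T(uₙ)R) = Pⁿ(T(uₙ))R = T(z)R`. -/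
theorem compression_mul_rightCreation (hsum : HasSum ω 1) (hz : z ∈ peripheralSpace D.endo)
    (hW : D.endo W = W) (hR : IsRightCreation e j (D.compression W)) :
    D.compression (z * W) = D.compression z * D.compression W := by
  have h1 := fockMap_one e hsum
  obtain ⟨u, hu0, -, hu⟩ := D.exists_backward_orbit hz
  have hu' : ∀ n, D.endo^[n] (u n) = z := fun n => hu0 ▸ hu n 0
  ext1 g'
  refine ext_inner_left ℂ fun g => ?_
  refine tendsto_nhds_unique (D.tendsto_inner_compression_mul h1 hu'
    (fun n => Function.iterate_fixed hW n) g g') (tendsto_const_nhds.congr fun n => ?_)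
  rw [fockMap_iterate_mul_rightCreation hsum.summable hR, ← D.compression_endo_iterate h1, hu']

theorem inner_concat_compression_rightCreation_mul (hsum : HasSum ω 1)
    (hz : z ∈ peripheralSpace D.endo)
    (hW : D.endo W = W) (hR : IsRightCreation e j (D.compression W)) (J : List Θ) (k : Θ)
    (g : FockSpace H) :
    inner ℂ (wordVector e (J ++ [k])) (D.compression (W * z) g) =
      (if k = j then 1 else 0) * inner ℂ (wordVector e J) (D.compression z g) := by
  have h1 := fockMap_one e hsum
  obtain ⟨u, hu0, -, hu⟩ := D.exists_backward_orbit hz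
  have hu' : ∀ n, D.endo^[n] (u n) = z := fun n => hu0 ▸ hu n 0
  refine tendsto_nhds_unique (D.tendsto_inner_compression_mul h1
    (fun n => Function.iterate_fixed hW n) hu' _ g) (tendsto_const_nhds.congr fun n => ?_)
  rw [inner_concat_fockMap_iterate_rightCreation_mul hsum.summable hR,
    ← D.compression_endo_iterate h1, hu']

/-- The factor `θ(z)` on the left compensates for the power of `P_ω` spent on creating the letter
`j`. -/
theorem inner_vacuum_compression_rightCreation_mul_endo (hsum : HasSum ω 1)
    (hz : z ∈ peripheralSpace D.endo)
    (hW : D.endo W = W) (hR : IsRightCreation e j (D.compression W)) (g : FockSpace H) :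
    inner ℂ (vacuum H) (D.compression (W * D.endo z) g) =
      ω j * inner ℂ (vacuum H) (D.compression z (leftCreation (e j) g)) := by
  have h1 := fockMap_one e hsum
  obtain ⟨u, hu0, -, hu⟩ := D.exists_backward_orbit hz
  have hu' : ∀ n, D.endo^[n] (u n) = z := fun n => hu0 ▸ hu n 0
  have hu'' : ∀ n, D.endo^[n] (D.endo (u n)) = D.endo z := fun n => by
    rw [← Function.iterate_succ_apply, Function.iterate_succ_apply', hu']
  -- The backward orbit of `θ(z)` is that of `z` shifted by one: `v (n + 1) = u n`. The limit is
  -- accordingly taken along `n + 1`.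
  let v : ℕ → D.alg.toStarSubalgebra := fun n => n.casesOn (D.endo z) fun n => u n
  have hv : ∀ n, D.endo^[n] (v n) = D.endo z := by
    rintro (_ | n)
    · rfl
    · exact hu'' n
  refine tendsto_nhds_unique ((tendsto_add_atTop_iff_nat 1).2
    (D.tendsto_inner_compression_mul h1 (fun n => Function.iterate_fixed hW n) hv _ g))
    (tendsto_const_nhds.congr fun n => ?_)
  rw [inner_vacuum_fockMap_iterate_rightCreation_mul hsum.summable hR,
    ← D.compression_endo_iterate h1]
  exact congrArg (fun T => (ω j : ℂ) * inner ℂ (vacuum H) (D.compression T _)) (hu' n).symm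

theorem norm_wordVector (e : HilbertBasis Θ ℂ H) (I : List Θ) : ‖wordVector e I‖ = 1 :=
  (orthonormal_iff_ite.2 (inner_wordVector e)).1 I

variable {W : Θ → D.alg.toStarSubalgebra}

/-- The vacuum row of a peripheral element that commutes with the lifted right creation
operators. -/
theorem inner_vacuum_compression_eq_zero [Nontrivial Θ] (hpos : ∀ i, 0 < ω i) (hsum : HasSum ω 1)
    (hW : ∀ j, D.endo (W j) = W j) (hR : ∀ j, IsRightCreation e j (D.compression (W j)))
    (hz : z ∈ peripheralSpace D.endo) (hcomm : ∀ j, z * W j = W j * z) {I : List Θ}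
    (hI : I ≠ []) : inner ℂ (vacuum H) (D.compression z (wordVector e I)) = 0 := by
  -- With two distinct letters `a`, `b`, every `j` differs from one of them, so `ω_j` is at most `1`
  -- minus the weight of that one.
  obtain ⟨c, hc0, hc1, hc⟩ : ∃ c : ℝ, 0 ≤ c ∧ c < 1 ∧ ∀ j, ω j ≤ c := by
    obtain ⟨a, b, hab⟩ := exists_pair_ne Θ
    have hle : ∀ i j, i ≠ j → ω i ≤ 1 - ω j := by
      intro i j hij
      have h := sum_le_hasSum {i, j} (fun k _ => (hpos k).le) hsum
      rw [Finset.sum_pair hij] at h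
      linarith
    refine ⟨1 - min (ω a) (ω b), ?_, by have := lt_min (hpos a) (hpos b); linarith, fun j => ?_⟩
    · have := hle a b hab
      have := min_le_right (ω a) (ω b)
      have := hpos a
      linarith
    · by_cases hj : j = a
      · subst hj
        have := hle j b hab
        have := min_le_right (ω j) (ω b)
        linarith
      · have := hle j a hj
        have := min_le_left (ω a) (ω b)
        linarith
  -- The bound is uniform in `z` and `I` because each step replaces `z` by its preimage under `θ`
  -- and rotates the word `I'j` to `jI'`, which is again nonempty.
  have key : ∀ (k : ℕ) (z : D.alg.toStarSubalgebra), z ∈ peripheralSpace D.endo →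
      (∀ j, z * W j = W j * z) → ∀ I : List Θ, I ≠ [] →
      ‖inner ℂ (vacuum H) (D.compression z (wordVector e I))‖ ≤ c ^ k * ‖z‖ := by
    intro k
    induction k with
    | zero =>
      intro z _ _ I _
      rw [pow_zero, one_mul, ← wordVector_nil e]
      refine (norm_inner_le_norm _ _).trans ?_
      rw [norm_wordVector, one_mul]
      have h := ContinuousLinearMap.le_of_opNorm_le _ (D.norm_compression_le z) (wordVector e I)
      rwa [norm_wordVector, mul_one] at h
    | succ k ih =>
      intro z hz hcomm I hI
      obtain ⟨I, j, rfl⟩ : ∃ I' j, I = I' ++ [j] :=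
        ⟨_, _, (List.dropLast_append_getLast hI).symm⟩
      obtain ⟨y, hy, rfl⟩ := D.exists_endo_eq hz
      -- `θ` fixes `W j` and is injective on the peripheral space, so the commutation of `θ(y)`
      -- descends to `y`.
      have hycomm : ∀ j, y * W j = W j * y := by
        intro j
        have hWj : W j ∈ peripheralSpace D.endo :=
          mem_peripheralSpace_of_eigen (c := 1) norm_one (by rw [hW, one_smul])
        refine D.endo_injOn (D.mul_mem_peripheralSpace hy hWj)
          (D.mul_mem_peripheralSpace hWj hy) ?_
        rw [map_mul, map_mul, hW, hcomm]
      have h1 : D.compression (D.endo y) (wordVector e (I ++ [j])) =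
          D.compression (D.endo y * W j) (wordVector e I) := by
        rw [compression_mul_rightCreation hsum hz (hW j) (hR j), ← hR j I]
        rfl
      rw [h1, hcomm, inner_vacuum_compression_rightCreation_mul_endo hsum hy (hW j) (hR j),
        ← wordVector_cons, norm_mul, Complex.norm_real, Real.norm_of_nonneg (hpos j).le,
        D.norm_endo hy, pow_succ', mul_assoc]
      exact mul_le_mul (hc j) (ih y hy hycomm _ (by simp)) (norm_nonneg _) hc0
  rw [← norm_le_zero_iff]
  have hlim := (tendsto_pow_atTop_nhds_zero_of_lt_one hc0 hc1).mul_const ‖z‖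
  rw [zero_mul] at hlim
  exact ge_of_tendsto' hlim fun k => key k z hz hcomm I hI

/-- Since `T(z)e_{Ij} = T(W_j z)e_I`, the entry at `(Jk, Ij)` is `δ_{jk}` times the entry at `(J,
I)`. Stripping last letters ends in the vacuum row or the vacuum column. -/
theorem inner_compression_wordVector [Nontrivial Θ] (hpos : ∀ i, 0 < ω i) (hsum : HasSum ω 1)
    (hW : ∀ j, D.endo (W j) = W j) (hR : ∀ j, IsRightCreation e j (D.compression (W j)))
    (hz : z ∈ peripheralSpace D.endo) (hcomm : ∀ j, z * W j = W j * z)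
    (hcomm' : ∀ j, z * star (W j) = star (W j) * z) (I J : List Θ) :
    inner ℂ (wordVector e J) (D.compression z (wordVector e I)) =
      if I = J then inner ℂ (vacuum H) (D.compression z (vacuum H)) else 0 := by
  induction I using List.reverseRecOn generalizing J with
  | nil =>
    by_cases hJ : J = []
    · subst hJ
      rw [if_pos rfl, wordVector_nil]
    -- The vacuum column of `z` is the conjugate of the vacuum row of `star z`, which commutes with
    -- `W j` because `z` commutes with `star (W j)`.
    · rw [if_neg (Ne.symm hJ), wordVector_nil, ← inner_conj_symm,
        ← ContinuousLinearMap.adjoint_inner_right, ← ContinuousLinearMap.star_eq_adjoint,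
        ← D.compression_star, inner_vacuum_compression_eq_zero hpos hsum hW hR
          (D.star_mem_peripheralSpace hz) (fun j => ?_) hJ, map_zero]
      have h := congrArg star (hcomm' j)
      rw [star_mul, star_mul, star_star] at h
      exact h.symm
  | append_singleton I j ih =>
    induction J using List.reverseRecOn with
    | nil =>
      rw [wordVector_nil, inner_vacuum_compression_eq_zero hpos hsum hW hR hz hcomm (by simp),
        if_neg (by simp)]
    | append_singleton J k _ =>
      have h1 : D.compression z (wordVector e (I ++ [j])) =
          D.compression (z * W j) (wordVector e I) := by
        rw [compression_mul_rightCreation hsum hz (hW j) (hR j), ← hR j I]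
        rfl
      rw [h1, hcomm, inner_concat_compression_rightCreation_mul hsum hz (hW j) (hR j), ih]
      by_cases h1 : j = k
      · by_cases h2 : I = J <;> simp [h1, h2]
      · simp [h1, Ne.symm h1]

theorem inner_wordVector_of_mem_relativeCommutant [Nontrivial Θ] (hpos : ∀ i, 0 < ω i)
    (hsum : HasSum ω 1) {x : FockSpace H →L[ℂ] FockSpace H} (hx : x ∈ D.relativeCommutant)
    (I J : List Θ) : inner ℂ (wordVector e J) (x (wordVector e I)) =
      if I = J then inner ℂ (vacuum H) (x (vacuum H)) else 0 := by
  have h1 := fockMap_one e hsum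
  choose W hW hR using D.exists_rightCreation_lift hsum
  have h := inner_compression_wordVector hpos hsum hW hR (D.lift_mem h1 hx.1)
    (fun j => lift_mul_comm_of_mem_relativeCommutant hsum hx (hW j))
    -- The adjoints of the lifts are fixed by `θ` too, so commutation with them is part of the
    -- hypothesis on `x`.
    (fun j => lift_mul_comm_of_mem_relativeCommutant hsum hx (by rw [map_star, hW])) I J
  rwa [D.compression_lift h1 hx.1] at h

end MinimalDilation

variable [DecidableEq Θ]

theorem eq_smul_one_of_inner_wordVector (e : HilbertBasis Θ ℂ H)
    {x : FockSpace H →L[ℂ] FockSpace H} {c : ℂ}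
    (h : ∀ I J, inner ℂ (wordVector e J) (x (wordVector e I)) = if I = J then c else 0) :
    x = c • (1 : FockSpace H →L[ℂ] FockSpace H) := by
  obtain ⟨b, hb⟩ := exists_wordBasis e
  refine ContinuousLinearMap.ext_on (dense_span_wordVector e) ?_
  rintro _ ⟨I, rfl⟩
  apply b.repr.injective
  ext J
  rw [b.repr_apply_apply, b.repr_apply_apply, hb, h]
  change _ = inner ℂ _ (c • wordVector e I)
  rw [inner_smul_right, inner_wordVector]
  by_cases hIJ : I = J
  · simp [hIJ]
  · simp [hIJ, Ne.symm hIJ]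

end RelativeCommutant

end FullFock

theorem theorem3 {H : Type*} [NormedAddCommGroup H] [InnerProductSpace ℂ H] [CompleteSpace H]
    {Θ : Type*} [Countable Θ] [Nontrivial Θ] [DecidableEq Θ] (e : HilbertBasis Θ ℂ H)
    (ω : Θ → ℝ) (hpos : ∀ i, 0 < ω i) (hsum : HasSum ω 1)
    {K : Type*} [NormedAddCommGroup K] [InnerProductSpace ℂ K] [CompleteSpace K]
    (D : MinimalDilation K (fockMap e ω)) :
    (∀ x ∈ D.relativeCommutant,
      (∀ I J : List Θ, inner ℂ (wordVector e J) (x (wordVector e I)) =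
        if I = J then inner ℂ (vacuum H) (x (vacuum H)) else 0) ∧
      x = inner ℂ (vacuum H) (x (vacuum H)) • (1 : FockSpace H →L[ℂ] FockSpace H)) ∧
    D.relativeCommutant = {x | ∃ c : ℂ, x = c • (1 : FockSpace H →L[ℂ] FockSpace H)} := by
  have h : ∀ x ∈ D.relativeCommutant,
      (∀ I J : List Θ, inner ℂ (wordVector e J) (x (wordVector e I)) =
        if I = J then inner ℂ (vacuum H) (x (vacuum H)) else 0) ∧
      x = inner ℂ (vacuum H) (x (vacuum H)) • (1 : FockSpace H →L[ℂ] FockSpace H) := by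
    intro x hx
    have hx' := MinimalDilation.inner_wordVector_of_mem_relativeCommutant hpos hsum hx
    exact ⟨hx', eq_smul_one_of_inner_wordVector e hx'⟩
  refine ⟨h, Set.ext fun x => ⟨fun hx => ⟨_, (h x hx).2⟩, ?_⟩⟩
  rintro ⟨c, rfl⟩
  exact MinimalDilation.smul_one_mem_relativeCommutant hsum c
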